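/- Let $k$ be a field of characteristic zero and let $A=\bigoplus_{i\ge 0}A_i$ be a standard graded artinian $k$-algebra, that is, an artinian quotient of a polynomial ring $k[y_1,\dots,y_m]$ (all $y_j$ of degree one) by a homogeneous ideal. Such an algebra has the weak Lefschetz property (WLP) if there is a linear form $\ell\in A_1$ such that the multiplication map $\cdot\ell:A_i\to A_{i+1}$ has full rank for every $i\ge 0$, and the strong Lefschetz property (SLP) if there is a linear form $\ell\in A_1$ such that $\cdot\ell^t:A_i\to A_{i+t}$ has full rank for all $t\ge 1$ and $i\ge 0$. Put $h_i=\dim_k A_i$, with $h_i=0$ for $i<0$. The algebra $A$ is almost centered if for all $i<j$ the following two conditions hold: - if $h_i<h_j$, then $h_{i-s}\le h_{j+s}$ for all $s\ge 0$; - if $h_i>h_j$, then $h_{i-s}\ge h_{j+s}$ for all $s\ge 0$. Then $A\otimes_k k[x_1,\dots,x_n]/(x_1^2,\dots,x_n^2)$, graded by total degree with each $x_j$ in degree one, has the WLP for all $n\ge 0$ if and only if $A$ is almost centered and has the SLP. -/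

import Mathlib

open scoped TensorProduct

noncomputable section

namespace Lefschetz

universe u v w

variable {k : Type u} [Field k] {A : Type v} [CommRing A] [Algebra k A]
  {B : Type w} [CommRing B] [Algebra k B]

/-- A graded `k`-algebra `A = ⨁ 𝒜 i` is standard graded if its degree zero part consists of the
scalars, its degree one part is finite dimensional, and it is generated by its degree one part.
Equivalently, `A` is a quotient of some `k[x₁, …, xₘ]` by a homogeneous ideal, with the induced
grading. -/
structure IsStandardGraded (𝒜 : ℕ → Submodule k A) [GradedAlgebra 𝒜] : Prop where
  zero_eq : 𝒜 0 = LinearMap.range (Algebra.linearMap k A)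
  finite_one : Module.Finite k (𝒜 1)
  adjoin_one : Algebra.adjoin k (𝒜 1 : Set A) = ⊤

/-- A linear map between finite dimensional spaces has full rank if its rank is the smaller of
the dimensions of the source and the target. -/
def HasFullRank {V : Type v} {W : Type w} [AddCommGroup V] [Module k V] [AddCommGroup W]
    [Module k W] (f : V →ₗ[k] W) : Prop :=
  Module.finrank k (LinearMap.range f) = min (Module.finrank k V) (Module.finrank k W)

lemma pow_mul_mem (𝒜 : ℕ → Submodule k A) [SetLike.GradedMonoid 𝒜] {l : A} (hl : l ∈ 𝒜 1)
    (t i : ℕ) {a : A} (ha : a ∈ 𝒜 i) : LinearMap.mulLeft k (l ^ t) a ∈ 𝒜 (i + t) := by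
  have h := SetLike.mul_mem_graded (SetLike.pow_mem_graded t hl) ha
  simpa [add_comm] using h

/-- Multiplication by `l ^ t` as a map `𝒜 i → 𝒜 (i + t)`, for a linear form `l`. -/
def mulPow (𝒜 : ℕ → Submodule k A) [SetLike.GradedMonoid 𝒜] (l : 𝒜 1) (t i : ℕ) :
    𝒜 i →ₗ[k] 𝒜 (i + t) :=
  (LinearMap.mulLeft k ((l : A) ^ t)).restrict fun _ ha => pow_mul_mem 𝒜 l.2 t i ha

/-- The weak Lefschetz property. -/
def HasWLP (𝒜 : ℕ → Submodule k A) [SetLike.GradedMonoid 𝒜] : Prop :=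
  ∃ l : 𝒜 1, ∀ i : ℕ, HasFullRank (mulPow 𝒜 l 1 i)

/-- The strong Lefschetz property: one linear form works for all powers and all degrees. -/
def HasSLP (𝒜 : ℕ → Submodule k A) [SetLike.GradedMonoid 𝒜] : Prop :=
  ∃ l : 𝒜 1, ∀ t : ℕ, 1 ≤ t → ∀ i : ℕ, HasFullRank (mulPow 𝒜 l t i)

/-- The Hilbert function `i ↦ dim 𝒜 i`, extended by zero to negative degrees. -/
def hilbert (𝒜 : ℕ → Submodule k A) (i : ℤ) : ℕ :=
  if 0 ≤ i then Module.finrank k (𝒜 i.toNat) else 0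

/-- `h` takes the value zero in all degrees outside the range from zero to the socle degree. -/
def IsAlmostCentered (𝒜 : ℕ → Submodule k A) : Prop :=
  (∀ i j : ℤ, i < j → hilbert 𝒜 i < hilbert 𝒜 j →
    ∀ s : ℕ, hilbert 𝒜 (i - s) ≤ hilbert 𝒜 (j + s)) ∧
  (∀ i j : ℤ, i < j → hilbert 𝒜 j < hilbert 𝒜 i →
    ∀ s : ℕ, hilbert 𝒜 (j + s) ≤ hilbert 𝒜 (i - s))

/-- The degree `d` part of the tensor product of two graded algebras is
the sum of all `𝒜 i ⊗ ℬ j` with `i + j = d`. -/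
def tensorGrading (𝒜 : ℕ → Submodule k A) (ℬ : ℕ → Submodule k B) (d : ℕ) :
    Submodule k (A ⊗[k] B) :=
  Submodule.span k {z | ∃ i j : ℕ, i + j = d ∧ ∃ a ∈ 𝒜 i, ∃ b ∈ ℬ j, a ⊗ₜ[k] b = z}

instance tensorGrading_gradedMonoid (𝒜 : ℕ → Submodule k A) (ℬ : ℕ → Submodule k B)
    [SetLike.GradedMonoid 𝒜] [SetLike.GradedMonoid ℬ] :
    SetLike.GradedMonoid (tensorGrading 𝒜 ℬ) where
  one_mem := Submodule.subset_span
    ⟨0, 0, rfl, 1, SetLike.one_mem_graded 𝒜, 1, SetLike.one_mem_graded ℬ, rfl⟩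
  mul_mem := by
    intro d e x y hx hy
    have h := Submodule.mul_mem_mul hx hy
    rw [tensorGrading, tensorGrading, Submodule.span_mul_span] at h
    refine Submodule.span_mono ?_ h
    rintro _ ⟨_, ⟨i, j, rfl, a, ha, b, hb, rfl⟩, _, ⟨i', j', rfl, a', ha', b', hb', rfl⟩, rfl⟩
    exact ⟨i + i', j + j', by omega, a * a', SetLike.mul_mem_graded ha ha',
      b * b', SetLike.mul_mem_graded hb hb', by simp⟩

variable (k)

/-- The ideal `(x₁², …, xₙ²)` of `k[x₁, …, xₙ]`. -/
def squaresIdeal (n : ℕ) : Ideal (MvPolynomial (Fin n) k) :=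
  Ideal.span (Set.range fun i : Fin n => (MvPolynomial.X i : MvPolynomial (Fin n) k) ^ 2)

/-- The algebra `k[x₁, …, xₙ] / (x₁², …, xₙ²)`. -/
abbrev SquaresAlgebra (n : ℕ) : Type u := MvPolynomial (Fin n) k ⧸ squaresIdeal k n

/-- The degree `d` part of `k[x₁, …, xₙ] / (x₁², …, xₙ²)`: the classes of forms of degree `d`. -/
def squaresGrading (n d : ℕ) : Submodule k (SquaresAlgebra k n) :=
  (MvPolynomial.homogeneousSubmodule (Fin n) k d).map
    (Ideal.Quotient.mkₐ k (squaresIdeal k n)).toLinearMap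

instance squaresGrading_gradedMonoid (n : ℕ) : SetLike.GradedMonoid (squaresGrading k n) where
  one_mem := ⟨1, MvPolynomial.isHomogeneous_one _ _, map_one (Ideal.Quotient.mkₐ k (squaresIdeal k n))⟩
  mul_mem := by
    rintro d e _ _ ⟨p, hp, rfl⟩ ⟨q, hq, rfl⟩
    exact ⟨p * q, MvPolynomial.IsHomogeneous.mul hp hq,
      map_mul (Ideal.Quotient.mkₐ k (squaresIdeal k n)) p q⟩

end Lefschetz

end

/-! A linear form ℓ splits `A` into strings [a, b]: a vector in degree a and its successive images
under ℓ, the last nonzero one in degree b. In characteristic zero, adjoining x with x² = 0 and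
replacing ℓ by ℓ + cx, c ≠ 0, turns [a, b] into [a, b+1] and [a+1, b] (empty if a = b). Lengths
spread out, but the endpoint sum a + b always grows by exactly one.

Full rank in degree m fails exactly when one string ends at m and another starts at m + 1; their
endpoint sums then differ by at least two. Hence, if the endpoint sums in `A` differ pairwise by at
most one, the WLP holds for every n (`fullRank_of_balanced`). Conversely, two strings whose sums
differ by two or more have descendants clashing in this way for every large n of the right parity
(`not_unbalanced_of_fullRank`). For a fixed ℓ, balance of the endpoint sums amounts to `A` being
almost centered with ℓ a strong Lefschetz element (`fullRank_of_not_unbalanced`,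
`almostCentered_of_not_unbalanced`, `not_unbalanced_of_almostCentered`).

No string decomposition is constructed. The number of strings containing [i, j] is the rank of
ℓ^(j-i) from degree i to degree j, and the splitting rule becomes a recursion on ranks
(`rankBetween_double`). Since weak Lefschetz elements may vary with n, a genericity argument
(`IsGenericCone.inter`) supplies one form that works for two consecutive large n, which covers both
parities. -/

namespace Lefschetz

/-! ### Combinatorics of rank tables under repeated doubling -/

/-- The formal properties of the ranks `r n i j` of the maps `Mₙ i → Mₙ j` (`i ≤ j`) given by the
powers of operators `Lₙ` of degree one on graded spaces `Mₙ`, where `Mₙ₊₁ = Mₙ ⊕ Mₙ(-1)` and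
`Lₙ₊₁ (u, v) = (Lₙ u, Lₙ v + c u)` with a nonzero scalar `c`. -/
structure IsDoublingTable (r : ℕ → ℤ → ℤ → ℕ) : Prop where
  diag : ∀ n i, r (n + 1) i i = r n i i + r n (i - 1) (i - 1)
  step : ∀ n i j, i < j → r (n + 1) i j = r n i (j - 1) + r n (i - 1) j
  anti : ∀ n i j, i ≤ j → r n i (j + 1) ≤ r n i j
  mono : ∀ n i j, i ≤ j → r n (i - 1) j ≤ r n i j
  surj : ∀ n i, r n i (i + 1) = r n (i + 1) (i + 1) → ∀ j, i + 1 ≤ j → r n i j = r n (i + 1) j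

/-- In terms of a decomposition into strings (Jordan blocks): there is a string `[a, q]` with
`a ≤ p ≤ q` and a string `[p', b]` with `p' ≤ q' ≤ b` such that the centre of `[p', q']` exceeds
the centre of `[p, q]` by at least one. -/
def HasUnbalancedPair (r : ℤ → ℤ → ℕ) : Prop :=
  ∃ p q p' q' : ℤ, p ≤ q ∧ p' ≤ q' ∧ r p (q + 1) < r p q ∧ r (p' - 1) q' < r p' q' ∧
    p + q + 2 ≤ p' + q'

namespace IsDoublingTable

variable {r : ℕ → ℤ → ℤ → ℕ}

/-- Tracing a string back to its ancestor at level 0 lowers the endpoint sum by one per level. The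
inequality in the conclusion appears because i only bounds the start of the string. -/
lemma exists_end (h : IsDoublingTable r) (n : ℕ) :
    ∀ i j : ℤ, i ≤ j → r n i (j + 1) < r n i j →
      ∃ p q : ℤ, p ≤ q ∧ r 0 p (q + 1) < r 0 p q ∧ p + q + n ≤ i + j := by
  induction n with
  | zero => exact fun i j hij hr => ⟨i, j, hij, hr, by simp⟩
  | succ n ih =>
    intro i j hij hr
    have key : ∃ i' j' : ℤ, i' ≤ j' ∧ r n i' (j' + 1) < r n i' j' ∧ i' + j' + 1 ≤ i + j := by
      have h1 := h.step n i (j + 1) (by omega)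
      rcases hij.lt_or_eq with hlt | rfl
      · have h2 := h.step n i j hlt
        -- A string ending at j has a parent ending at j - 1 with the same start, or a parent ending
        -- at j with start one lower.
        by_cases h3 : r n i j < r n i (j - 1)
        · exact ⟨i, j - 1, by omega, by simpa using h3, by omega⟩
        · refine ⟨i - 1, j, by omega, ?_, by omega⟩
          rw [add_sub_cancel_right] at h1
          omega
      · have h2 := h.diag n i
        by_cases h3 : r n (i - 1) i < r n (i - 1) (i - 1)
        · exact ⟨i - 1, i - 1, le_rfl, by simpa using h3, by omega⟩
        · refine ⟨i - 1, i, by omega, ?_, by omega⟩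
          rw [add_sub_cancel_right] at h1
          omega
    obtain ⟨i', j', hij', hr', hs⟩ := key
    obtain ⟨p, q, hpq, hr0, hs0⟩ := ih i' j' hij' hr'
    exact ⟨p, q, hpq, hr0, by push_cast; omega⟩

lemma exists_start (h : IsDoublingTable r) (n : ℕ) :
    ∀ i j : ℤ, i ≤ j → r n (i - 1) j < r n i j →
      ∃ p q : ℤ, p ≤ q ∧ r 0 (p - 1) q < r 0 p q ∧ i + j ≤ p + q + n := by
  induction n with
  | zero => exact fun i j hij hr => ⟨i, j, hij, hr, by simp⟩
  | succ n ih =>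
    intro i j hij hr
    have key : ∃ i' j' : ℤ, i' ≤ j' ∧ r n (i' - 1) j' < r n i' j' ∧ i + j ≤ i' + j' + 1 := by
      have h1 := h.step n (i - 1) j (by omega)
      rcases hij.lt_or_eq with hlt | rfl
      · have h2 := h.step n i j hlt
        by_cases h3 : r n (i - 1) (j - 1) < r n i (j - 1)
        · exact ⟨i, j - 1, by omega, h3, by omega⟩
        · exact ⟨i - 1, j, by omega, by omega, by omega⟩
      · have h2 := h.diag n i
        by_cases h3 : r n (i - 1) i < r n i i
        · exact ⟨i, i, le_rfl, h3, by omega⟩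
        · exact ⟨i - 1, i, by omega, by omega, by omega⟩
    obtain ⟨i', j', hij', hr', hs⟩ := key
    obtain ⟨p, q, hpq, hr0, hs0⟩ := ih i' j' hij' hr'
    exact ⟨p, q, hpq, hr0, by push_cast; omega⟩

/-- A failure of full rank gives a kernel, hence a string ending at i, and a cokernel, hence a
string starting at i + 1. Their level 0 ancestors form an unbalanced pair. -/
lemma fullRank_of_balanced (h : IsDoublingTable r) (hb : ¬ HasUnbalancedPair (r 0)) (n : ℕ)
    (i : ℤ) : r n i (i + 1) = min (r n i i) (r n (i + 1) (i + 1)) := by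
  by_contra hne
  have h1 := h.anti n i i le_rfl
  have h2 := h.mono n (i + 1) (i + 1) le_rfl
  rw [add_sub_cancel_right] at h2
  obtain ⟨p, q, hpq, hr, hs⟩ := h.exists_end n i i le_rfl (by omega)
  obtain ⟨p', q', hpq', hr', hs'⟩ := h.exists_start n (i + 1) (i + 1) le_rfl
    (by rw [add_sub_cancel_right]; omega)
  exact hb ⟨p, q, p', q', hpq, hpq', hr, hr', by omega⟩

/-- This lemma and the next three follow the two children [a, b+1] and [a+1, b] of a string,
recording either its exact end and a bound on its start, or the reverse. -/
lemma end_right (h : IsDoublingTable r) {n : ℕ} {i j : ℤ} (hij : i ≤ j)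
    (hr : r n i (j + 1) < r n i j) : r (n + 1) i (j + 1 + 1) < r (n + 1) i (j + 1) := by
  have h1 := h.step n i (j + 1) (by omega)
  have h2 := h.step n i (j + 1 + 1) (by omega)
  have h3 := h.anti n (i - 1) (j + 1) (by omega)
  rw [add_sub_cancel_right] at h1 h2
  omega

lemma end_left (h : IsDoublingTable r) {n : ℕ} {i j : ℤ} (hij : i + 1 ≤ j)
    (hr : r n i (j + 1) < r n i j) : r (n + 1) (i + 1) (j + 1) < r (n + 1) (i + 1) j := by
  have h1 := h.step n (i + 1) (j + 1) (by omega)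
  rw [add_sub_cancel_right, add_sub_cancel_right] at h1
  rcases hij.lt_or_eq with hlt | rfl
  · have h2 := h.step n (i + 1) j hlt
    have h3 := h.anti n (i + 1) (j - 1) (by omega)
    rw [sub_add_cancel] at h3
    rw [add_sub_cancel_right] at h2
    omega
  · have h2 := h.diag n (i + 1)
    have h3 := h.anti n i i le_rfl
    rw [add_sub_cancel_right] at h2
    omega

lemma start_left (h : IsDoublingTable r) {n : ℕ} {i j : ℤ} (hij : i + 1 ≤ j)
    (hr : r n (i - 1) j < r n i j) : r (n + 1) i j < r (n + 1) (i + 1) j := by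
  have h1 := h.step n i j (by omega)
  rcases hij.lt_or_eq with hlt | rfl
  · have h2 := h.step n (i + 1) j hlt
    have h3 := h.mono n (i + 1) (j - 1) (by omega)
    rw [add_sub_cancel_right] at h2 h3
    omega
  · have h2 := h.diag n (i + 1)
    have h3 := h.mono n (i + 1) (i + 1) le_rfl
    rw [add_sub_cancel_right] at h1 h2 h3
    omega

lemma start_right (h : IsDoublingTable r) {n : ℕ} {i j : ℤ} (hij : i ≤ j)
    (hr : r n (i - 1) j < r n i j) : r (n + 1) (i - 1) (j + 1) < r (n + 1) i (j + 1) := by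
  have h1 := h.step n i (j + 1) (by omega)
  have h2 := h.step n (i - 1) (j + 1) (by omega)
  have h3 := h.mono n (i - 1) (j + 1) (by omega)
  rw [add_sub_cancel_right] at h1 h2
  omega

/-- The v moves of the end come before the u moves of the start, so the hypothesis on the final
interval keeps all intermediate intervals nonempty. -/
lemma end_add_add (h : IsDoublingTable r) {p q : ℤ} (hpq : p ≤ q)
    (hr : r 0 p (q + 1) < r 0 p q) (v u : ℕ) (huv : p + u ≤ q + v) :
    r (v + u) (p + u) (q + v + 1) < r (v + u) (p + u) (q + v) := by
  induction u with
  | zero =>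
    clear huv
    induction v with
    | zero => simpa using hr
    | succ v ih =>
      have := h.end_right (by push_cast; omega) ih
      simpa [add_assoc] using this
  | succ u ih =>
    push_cast at huv
    have := h.end_left (by omega) (ih (by omega))
    simpa [add_assoc] using this

lemma start_add_add (h : IsDoublingTable r) {p q : ℤ} (hpq : p ≤ q)
    (hr : r 0 (p - 1) q < r 0 p q) (v u : ℕ) (huv : p + u ≤ q + v) :
    r (v + u) (p + u - 1) (q + v) < r (v + u) (p + u) (q + v) := by
  induction u with
  | zero =>
    clear huv
    induction v with
    | zero => simpa using hr
    | succ v ih =>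
      have := h.start_right (by push_cast; omega) ih
      simpa [add_assoc] using this
  | succ u ih =>
    push_cast at huv
    have := h.start_left (by omega) (ih (by omega))
    rw [show p + u = p + (u + 1 : ℕ) - 1 by push_cast; ring] at this
    simpa [add_assoc] using this

/-- An unbalanced pair among the strings inside `[0, D]` obstructs the weak Lefschetz property for
one of any two consecutive large values of `n`. -/
lemma not_unbalanced_of_fullRank (h : IsDoublingTable r) {D N : ℕ}
    (h0 : ∀ p q : ℤ, p ≤ q → (p < 0 ∨ (D : ℤ) < q) → r 0 p q = 0) (hN : 2 * D + 2 ≤ N)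
    (hW : ∀ i : ℤ, r N i (i + 1) = min (r N i i) (r N (i + 1) (i + 1)))
    (hW' : ∀ i : ℤ, r (N + 1) i (i + 1) = min (r (N + 1) i i) (r (N + 1) (i + 1) (i + 1))) :
    ¬ HasUnbalancedPair (r 0) := by
  rintro ⟨p, q, p', q', hpq, hpq', hr, hr', hs⟩
  have hp : 0 ≤ p := by
    by_contra hneg
    have := h0 p q hpq (by omega)
    omega
  have hq : q ≤ D := by
    by_contra hneg
    have := h0 p q hpq (by omega)
    omega
  have hp' : 0 ≤ p' := by
    by_contra hneg
    have := h0 p' q' hpq' (by omega)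
    omega
  have hq' : q' ≤ D := by
    by_contra hneg
    have := h0 p' q' hpq' (by omega)
    omega
  obtain ⟨n, hn, hWn, m, hm⟩ : ∃ n, N ≤ n ∧
      (∀ i : ℤ, r n i (i + 1) = min (r n i i) (r n (i + 1) (i + 1))) ∧
      ∃ m : ℤ, p + q + n = 2 * m := by
    -- At level n the first interval has endpoint sum p + q + n. When this is 2m, the interval can
    -- be shrunk to [m, m]; one of N, N + 1 has the right parity.
    rcases Int.even_or_odd' (p + q + N) with ⟨m, hm | hm⟩
    · exact ⟨N, le_rfl, hW, m, hm⟩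
    · exact ⟨N + 1, by omega, hW', m + 1, by push_cast; omega⟩
  have he : r n m (m + 1) < r n m m := by
    have := h.end_add_add hpq hr (m - q).toNat (m - p).toNat (by omega)
    rwa [show (m - q).toNat + (m - p).toNat = n by omega,
      show p + ((m - p).toNat : ℤ) = m by omega, show q + ((m - q).toNat : ℤ) = m by omega] at this
  -- The second string is moved to start at m + 1. Its end stays at or beyond m + 1 by the gap of
  -- two, and largeness of N makes both move counts nonnegative.
  have hb := h.start_add_add hpq' hr' (n - (m + 1 - p').toNat) (m + 1 - p').toNat (by omega)
  rw [show n - (m + 1 - p').toNat + (m + 1 - p').toNat = n by omega,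
    show p' + ((m + 1 - p').toNat : ℤ) = m + 1 by omega, add_sub_cancel_right] at hb
  -- The string ending at m excludes injectivity, so full rank forces surjectivity, which the string
  -- starting at m + 1 contradicts.
  have hsurj : r n m (m + 1) = r n (m + 1) (m + 1) := by
    have := hWn m
    omega
  exact hb.ne (h.surj n m hsurj _ (by omega))

end IsDoublingTable

/-! ### Balance versus strong Lefschetz and almost centered, at one level -/

lemma exists_end_between {r : ℤ → ℤ → ℕ} {i j : ℤ} (hij : i ≤ j) (hr : r i j < r i i) :
    ∃ q : ℤ, i ≤ q ∧ q < j ∧ r i (q + 1) < r i q := by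
  induction j, hij using Int.leInduction with
  | base => omega
  | succ j hj ih =>
    by_cases h : r i j < r i i
    · obtain ⟨q, h1, h2, h3⟩ := ih h
      exact ⟨q, h1, by omega, h3⟩
    · exact ⟨j, hj, by omega, by omega⟩

lemma exists_start_between {r : ℤ → ℤ → ℕ} {i j : ℤ} (hij : i ≤ j) (hr : r i j < r j j) :
    ∃ p : ℤ, i < p ∧ p ≤ j ∧ r (p - 1) j < r p j := by
  induction i, hij using Int.leInductionDown with
  | base => omega
  | pred i hi ih =>
    by_cases h : r i j < r j j
    · obtain ⟨q, h1, h2, h3⟩ := ih h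
      exact ⟨q, by omega, h2, h3⟩
    · exact ⟨i, by omega, hi, by omega⟩

lemma fullRank_of_not_unbalanced {r : ℤ → ℤ → ℕ} (hb : ¬ HasUnbalancedPair r)
    (hle : ∀ i j, i ≤ j → r i j ≤ min (r i i) (r j j)) (i j : ℤ) (hij : i ≤ j) :
    r i j = min (r i i) (r j j) := by
  by_contra hne
  have := hle i j hij
  obtain ⟨q, h1, h2, h3⟩ := exists_end_between (r := r) hij (by omega)
  obtain ⟨p, h4, h5, h6⟩ := exists_start_between (r := r) hij (by omega)
  exact hb ⟨i, q, p, j, h1, h5, h3, h6, by omega⟩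

/-- Each strict inequality between Hilbert values forces a string to start or to end between the two
degrees. A violation of either condition thus produces a pair of strings, and symmetric widening by
s leaves the sum i + j unchanged, so this pair is unbalanced. -/
lemma almostCentered_of_not_unbalanced {r : ℤ → ℤ → ℕ} (hb : ¬ HasUnbalancedPair r)
    (hle : ∀ i j, i ≤ j → r i j ≤ min (r i i) (r j j)) :
    (∀ i j : ℤ, i < j → r i i < r j j → ∀ s : ℕ, r (i - s) (i - s) ≤ r (j + s) (j + s)) ∧
    (∀ i j : ℤ, i < j → r j j < r i i → ∀ s : ℕ, r (j + s) (j + s) ≤ r (i - s) (i - s)) := by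
  constructor
  · intro i j hij hr s
    by_contra! hlt
    have h1 := hle i j hij.le
    have h2 := hle (i - s) (j + s) (by omega)
    obtain ⟨p, h4, h5, h6⟩ := exists_start_between (r := r) hij.le (by omega)
    obtain ⟨q, h7, h8, h9⟩ := exists_end_between (r := r) (i := i - s) (j := j + s)
      (by omega) (by omega)
    exact hb ⟨i - s, q, p, j, h7, h5, h9, h6, by omega⟩
  · intro i j hij hr s
    by_contra! hlt
    have h1 := hle i j hij.le
    have h2 := hle (i - s) (j + s) (by omega)
    obtain ⟨p, h4, h5, h6⟩ := exists_start_between (r := r) (i := i - s) (j := j + s)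
      (by omega) (by omega)
    obtain ⟨q, h7, h8, h9⟩ := exists_end_between (r := r) hij.le (by omega)
    exact hb ⟨i, q, p, j + s, h7, h5, h9, h6, by omega⟩

lemma not_unbalanced_of_almostCentered {r : ℤ → ℤ → ℕ}
    (hr : ∀ i j, i ≤ j → r i j = min (r i i) (r j j))
    (anti : ∀ i j j', i ≤ j → j ≤ j' → r i j' ≤ r i j)
    (mono : ∀ i i' j, i ≤ i' → i' ≤ j → r i j ≤ r i' j)
    (h1 : ∀ i j : ℤ, i < j → r i i < r j j → ∀ s : ℕ, r (i - s) (i - s) ≤ r (j + s) (j + s))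
    (h2 : ∀ i j : ℤ, i < j → r j j < r i i → ∀ s : ℕ, r (j + s) (j + s) ≤ r (i - s) (i - s)) :
    ¬ HasUnbalancedPair r := by
  rintro ⟨p, q, p', q', hpq, hpq', hend, hstart, hs⟩
  have e1 := hr p q hpq
  have e2 := hr p (q + 1) (by omega)
  have e3 := hr p' q' hpq'
  have e4 := hr (p' - 1) q' (by omega)
  -- Full rank turns the two drops into h(q+1) < h(p) and h(p'-1) < h(q'). One of these intervals is
  -- widened symmetrically until it reaches p on the left or q' on the right; almost centeredness
  -- then contradicts the other drop.
  rcases lt_or_ge p p' with hp | hp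
  · have a1 := h1 (p' - 1) q' (by omega) (by omega) (p' - 1 - p).toNat
    rw [show p' - 1 - ((p' - 1 - p).toNat : ℤ) = p by omega] at a1
    have a2 := anti p (q + 1) (q' + (p' - 1 - p).toNat) (by omega) (by omega)
    have a3 := hr p (q' + (p' - 1 - p).toNat) (by omega)
    omega
  · have a1 := h2 p (q + 1) (by omega) (by omega) (q' - (q + 1)).toNat
    rw [show q + 1 + ((q' - (q + 1)).toNat : ℤ) = q' by omega] at a1
    have a2 := mono (p - (q' - (q + 1)).toNat) (p' - 1) q' (by omega) (by omega)
    have a3 := hr (p - (q' - (q + 1)).toNat) q' (by omega)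
    omega

end Lefschetz

namespace Lefschetz

/-! ### Ranks of powers of a degree one operator and of its double -/

section Rank

variable {k M M' : Type*} [Field k] [AddCommGroup M] [Module k M] [AddCommGroup M'] [Module k M']

/-- The rank of the map `P i → P j` (for `i ≤ j`) induced by a power of an operator `L` of degree
one. -/
noncomputable def rankBetween (P : ℤ → Submodule k M) (L : Module.End k M) (i j : ℤ) : ℕ :=
  Module.finrank k ((P i).map (L ^ (j - i).toNat))

lemma finrank_submodule_prod [FiniteDimensional k M] [FiniteDimensional k M']
    (p : Submodule k M) (q : Submodule k M') :
    Module.finrank k (p.prod q) = Module.finrank k p + Module.finrank k q := by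
  have hr : LinearMap.range (p.subtype.prodMap q.subtype) = p.prod q := by
    rw [LinearMap.range_prodMap, Submodule.range_subtype, Submodule.range_subtype]
  rw [← hr, LinearMap.finrank_range_of_inj
    (Prod.map_injective.2 ⟨p.injective_subtype, q.injective_subtype⟩), Module.finrank_prod]

lemma rankBetween_self (P : ℤ → Submodule k M) (L : Module.End k M) (i : ℤ) :
    rankBetween P L i i = Module.finrank k (P i) := by
  rw [rankBetween, sub_self, Int.toNat_zero, pow_zero, Module.End.one_eq_id, Submodule.map_id]

lemma rankBetween_add (P : ℤ → Submodule k M) (L : Module.End k M) (i : ℤ) (t : ℕ) :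
    rankBetween P L i (i + t) = Module.finrank k ((P i).map (L ^ t)) := by
  rw [rankBetween, add_sub_cancel_left, Int.toNat_natCast]

lemma map_pow_le {P : ℤ → Submodule k M} {L : Module.End k M}
    (hL : ∀ i, (P i).map L ≤ P (i + 1)) (i : ℤ) (t : ℕ) : (P i).map (L ^ t) ≤ P (i + t) := by
  induction t with
  | zero => simp [Module.End.one_eq_id]
  | succ t ih =>
    rw [pow_succ', Module.End.mul_eq_comp, Submodule.map_comp]
    exact (Submodule.map_mono ih).trans ((hL _).trans (by push_cast; rw [add_assoc]))

lemma rankBetween_anti [FiniteDimensional k M] (P : ℤ → Submodule k M) (L : Module.End k M)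
    {i j j' : ℤ} (hij : i ≤ j) (hj : j ≤ j') : rankBetween P L i j' ≤ rankBetween P L i j := by
  rw [rankBetween, rankBetween, show (j' - i).toNat = (j' - j).toNat + (j - i).toNat by omega,
    pow_add, Module.End.mul_eq_comp, Submodule.map_comp]
  exact Submodule.finrank_map_le _ _

lemma rankBetween_mono [FiniteDimensional k M] {P : ℤ → Submodule k M} {L : Module.End k M}
    (hL : ∀ i, (P i).map L ≤ P (i + 1)) {i i' j : ℤ} (hi : i ≤ i') (hij : i' ≤ j) :
    rankBetween P L i j ≤ rankBetween P L i' j := by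
  rw [rankBetween, rankBetween, show (j - i).toNat = (j - i').toNat + (i' - i).toNat by omega,
    pow_add, Module.End.mul_eq_comp, Submodule.map_comp]
  refine Submodule.finrank_mono (Submodule.map_mono ?_)
  have := map_pow_le hL i (i' - i).toNat
  rwa [show i + ((i' - i).toNat : ℤ) = i' by omega] at this

lemma rankBetween_le_min [FiniteDimensional k M] {P : ℤ → Submodule k M} {L : Module.End k M}
    (hL : ∀ i, (P i).map L ≤ P (i + 1)) {i j : ℤ} (hij : i ≤ j) :
    rankBetween P L i j ≤ min (rankBetween P L i i) (rankBetween P L j j) :=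
  le_min (rankBetween_anti P L le_rfl hij) (rankBetween_mono hL hij le_rfl)

lemma rankBetween_eq_of_surj [FiniteDimensional k M] {P : ℤ → Submodule k M}
    {L : Module.End k M} (hL : ∀ i, (P i).map L ≤ P (i + 1)) {i : ℤ}
    (h : rankBetween P L i (i + 1) = rankBetween P L (i + 1) (i + 1)) {j : ℤ} (hj : i + 1 ≤ j) :
    rankBetween P L i j = rankBetween P L (i + 1) j := by
  have hs : (P i).map L = P (i + 1) := by
    refine Submodule.eq_of_le_of_finrank_eq (hL i) ?_
    have h' := rankBetween_add P L i 1
    rw [pow_one, Nat.cast_one] at h'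
    rw [← h', h, rankBetween_self]
  rw [rankBetween, rankBetween, ← hs, ← Submodule.map_comp, ← Module.End.mul_eq_comp, ← pow_succ,
    show (j - (i + 1)).toNat + 1 = (j - i).toNat by omega]

/-- The operator `(u, v) ↦ (L u, L v + c u)`. -/
def doubleOp (L : Module.End k M) (c : k) : Module.End k (M × M) :=
  (L ∘ₗ LinearMap.fst k M M).prod (L ∘ₗ LinearMap.snd k M M + c • LinearMap.fst k M M)

@[simp] lemma doubleOp_apply (L : Module.End k M) (c : k) (x : M × M) :
    doubleOp L c x = (L x.1, L x.2 + c • x.1) := rfl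

lemma doubleOp_pow_succ_apply (L : Module.End k M) (c : k) (t : ℕ) (x : M × M) :
    (doubleOp L c ^ (t + 1)) x =
      ((L ^ (t + 1)) x.1, (L ^ (t + 1)) x.2 + ((t + 1 : ℕ) * c) • (L ^ t) x.1) := by
  induction t with
  | zero => simp
  | succ t ih =>
    rw [pow_succ', Module.End.mul_apply, ih, doubleOp_apply, pow_succ' L (t + 1)]
    simp only [Module.End.mul_apply, map_add, map_smul, Prod.mk.injEq, true_and]
    rw [← Module.End.mul_apply L (L ^ t), ← pow_succ', add_assoc, ← add_smul]
    congr 2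
    push_cast
    ring

/-- Shear `(u, v) ↦ (u - s L v, v)`. -/
def shear (L : Module.End k M) (s : k) : (M × M) ≃ₗ[k] (M × M) where
  toFun x := (x.1 - s • L x.2, x.2)
  invFun x := (x.1 + s • L x.2, x.2)
  map_add' x y := by simp [smul_add]; abel
  map_smul' a x := by simp [smul_sub, smul_comm a s]
  left_inv x := by simp
  right_inv x := by simp

@[simp] lemma shear_apply (L : Module.End k M) (s : k) (x : M × M) :
    shear L s x = (x.1 - s • L x.2, x.2) := rfl

@[simp] lemma shear_symm_apply (L : Module.End k M) (s : k) (x : M × M) :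
    (shear L s).symm x = (x.1 + s • L x.2, x.2) := rfl

/-- In the application q lies one degree below p, so the shear is homogeneous for the shifted direct
sum. -/
lemma map_shear {L : Module.End k M} (s : k) {p q : Submodule k M} (h : q.map L ≤ p) :
    (p.prod q).map (shear L s : (M × M) →ₗ[k] M × M) = p.prod q := by
  have hmem : ∀ v ∈ q, s • L v ∈ p := fun v hv =>
    p.smul_mem _ (h (Submodule.mem_map_of_mem hv))
  apply le_antisymm
  · rintro _ ⟨x, hx, rfl⟩
    exact ⟨p.sub_mem hx.1 (hmem _ hx.2), hx.2⟩
  · intro x hx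
    exact ⟨(shear L s).symm x, ⟨p.add_mem hx.1 (hmem _ hx.2), hx.2⟩, by simp⟩

/-- The rank of a positive power of `doubleOp L c`, computed by row and column operations. -/
lemma finrank_map_doubleOp_pow [FiniteDimensional k M] [CharZero k] {L : Module.End k M} {c : k}
    (hc : c ≠ 0) {p q : Submodule k M} (h : q.map L ≤ p) (t : ℕ) :
    Module.finrank k ((p.prod q).map (doubleOp L c ^ (t + 1))) =
      Module.finrank k (p.map (L ^ t)) + Module.finrank k (q.map (L ^ (t + 1 + 1))) := by
  set a : k := (t + 1 : ℕ) * c with ha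
  have ha0 : a ≠ 0 := mul_ne_zero (Nat.cast_ne_zero.2 t.succ_ne_zero) hc
  have key : ((p.prod q).map (doubleOp L c ^ (t + 1))).map
      (shear L a⁻¹ : (M × M) →ₗ[k] M × M) =
      (q.map (L ^ (t + 1 + 1))).prod (p.map (L ^ t)) := by
    rw [← map_shear a⁻¹ h, ← Submodule.map_comp, ← Submodule.map_comp]
    -- The power is the block matrix with L^(t+1) on the diagonal and a L^t below it. As a is
    -- invertible, L^t serves as a pivot: shears on both sides clear the diagonal and leave an
    -- antidiagonal matrix with blocks L^t and L^(t+2), up to nonzero scalars.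
    have hx : ∀ x : M × M, (shear L a⁻¹) ((doubleOp L c ^ (t + 1)) (shear L a⁻¹ x)) =
        (-a⁻¹ • (L ^ (t + 1 + 1)) x.2, a • (L ^ t) x.1) := by
      intro x
      have h1 : ∀ y, (L ^ (t + 1)) (L y) = (L ^ (t + 1 + 1)) y := fun y => by
        rw [pow_succ L (t + 1), Module.End.mul_apply]
      have h2 : ∀ y, L ((L ^ (t + 1)) y) = (L ^ (t + 1 + 1)) y := fun y => by
        rw [pow_succ' L (t + 1), Module.End.mul_apply]
      have h3 : ∀ y, L ((L ^ t) y) = (L ^ (t + 1)) y := fun y => by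
        rw [pow_succ', Module.End.mul_apply]
      have h4 : ∀ y, (L ^ t) (L y) = (L ^ (t + 1)) y := fun y => by
        rw [pow_succ, Module.End.mul_apply]
      simp only [shear_apply, doubleOp_pow_succ_apply, ← ha, map_sub, map_add, map_smul, h1, h2,
        h3, h4, smul_sub, smul_add, smul_smul, inv_mul_cancel₀ ha0, mul_inv_cancel₀ ha0, one_smul,
        Prod.mk.injEq, neg_smul]
      constructor <;> abel
    apply le_antisymm
    · rintro _ ⟨x, hxm, rfl⟩
      simp only [LinearMap.comp_apply, LinearEquiv.coe_coe, hx]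
      exact ⟨Submodule.smul_mem _ _ (Submodule.mem_map_of_mem hxm.2),
        Submodule.smul_mem _ _ (Submodule.mem_map_of_mem hxm.1)⟩
    · rintro ⟨_, _⟩ ⟨⟨v, hv, rfl⟩, ⟨u, hu, rfl⟩⟩
      refine ⟨(a⁻¹ • u, -a • v), ⟨p.smul_mem _ hu, q.smul_mem _ hv⟩, ?_⟩
      simp only [LinearMap.comp_apply, LinearEquiv.coe_coe, hx]
      simp [smul_smul, ha0]
  rw [← LinearEquiv.finrank_map_eq (shear L a⁻¹), key, finrank_submodule_prod, add_comm]

variable {P : ℤ → Submodule k M} {P' : ℤ → Submodule k M'} {L : Module.End k M}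
  {L' : Module.End k M'}

lemma pow_comp_of_comp {N : Type*} [AddCommGroup N] [Module k N] {K : Module.End k N}
    {Φ : N ≃ₗ[k] M'} (hΦ : ∀ x, L' (Φ x) = Φ (K x)) (t : ℕ) (x : N) :
    (L' ^ t) (Φ x) = Φ ((K ^ t) x) := by
  induction t with
  | zero => simp
  | succ t ih => rw [pow_succ', pow_succ', Module.End.mul_apply, Module.End.mul_apply, ih, hΦ]

lemma rankBetween_transport {N : Type*} [AddCommGroup N] [Module k N] {Q : ℤ → Submodule k N}
    {K : Module.End k N} (Φ : N ≃ₗ[k] M') (hΦ : ∀ x, L' (Φ x) = Φ (K x))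
    (hP : ∀ i, P' i = (Q i).map (Φ : N →ₗ[k] M')) (i j : ℤ) :
    rankBetween P' L' i j = rankBetween Q K i j := by
  have h : (L' ^ (j - i).toNat) ∘ₗ (Φ : N →ₗ[k] M') = (Φ : N →ₗ[k] M') ∘ₗ (K ^ (j - i).toNat) :=
    LinearMap.ext fun x => pow_comp_of_comp hΦ _ x
  rw [rankBetween, rankBetween, hP, ← Submodule.map_comp, h, Submodule.map_comp,
    LinearEquiv.finrank_map_eq]

lemma rankBetween_double_self [FiniteDimensional k M] (c : k) (i : ℤ) :
    rankBetween (fun i => (P i).prod (P (i - 1))) (doubleOp L c) i i =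
      rankBetween P L i i + rankBetween P L (i - 1) (i - 1) := by
  simp_rw [rankBetween_self, finrank_submodule_prod]

lemma rankBetween_double [FiniteDimensional k M] [CharZero k]
    (hL : ∀ i, (P i).map L ≤ P (i + 1)) {c : k} (hc : c ≠ 0) {i j : ℤ} (hij : i < j) :
    rankBetween (fun i => (P i).prod (P (i - 1))) (doubleOp L c) i j =
      rankBetween P L i (j - 1) + rankBetween P L (i - 1) j := by
  have h : (P (i - 1)).map L ≤ P i := by simpa using hL (i - 1)
  obtain ⟨t, rfl⟩ : ∃ t : ℕ, j = i + (t + 1 : ℕ) := ⟨(j - i - 1).toNat, by omega⟩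
  rw [rankBetween_add, finrank_map_doubleOp_pow hc h, ← rankBetween_add, ← rankBetween_add]
  congr 2 <;> push_cast <;> ring

end Rank

/-! ### Full rank along a line of linear maps -/

section FullRank

variable {k : Type*} [Field k]

/-- A bad t is nonzero and makes -1/t an eigenvalue of h, and h has only finitely many. -/
lemma finite_not_injective_one_add_smul {V : Type*} [AddCommGroup V] [Module k V]
    [FiniteDimensional k V] (h : Module.End k V) :
    {t : k | ¬ Function.Injective (1 + t • h : Module.End k V)}.Finite := by
  refine ((Module.End.finite_hasEigenvalue h).image fun μ => -μ⁻¹).subset ?_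
  intro t ht
  rw [Set.mem_ofPred_eq, ← LinearMap.ker_eq_bot, Submodule.eq_bot_iff] at ht
  push Not at ht
  obtain ⟨x, hx, hx0⟩ := ht
  rw [LinearMap.mem_ker, LinearMap.add_apply, Module.End.one_apply, LinearMap.smul_apply] at hx
  have ht0 : t ≠ 0 := by
    rintro rfl
    exact hx0 (by simpa using hx)
  refine ⟨-t⁻¹, Module.End.hasEigenvalue_of_hasEigenvector (x := x) ⟨?_, hx0⟩, by simp⟩
  rw [Module.End.mem_eigenspace_iff, neg_smul, eq_neg_iff_add_eq_zero]
  have := congrArg (fun y => t⁻¹ • y) hx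
  simpa [smul_add, smul_smul, ht0, add_comm] using this

variable {V : Type*} {W : Type*} [AddCommGroup V] [Module k V] [AddCommGroup W] [Module k W]

lemma hasFullRank_of_injective [FiniteDimensional k W] {f : V →ₗ[k] W} (hf : Function.Injective f) : HasFullRank f := by
  rw [HasFullRank, LinearMap.finrank_range_of_inj hf,
    min_eq_left (LinearMap.finrank_le_finrank_of_injective hf)]

lemma hasFullRank_of_surjective [FiniteDimensional k V] {f : V →ₗ[k] W} (hf : Function.Surjective f) :
    HasFullRank f := by
  have hr : LinearMap.range f = ⊤ := LinearMap.range_eq_top.2 hf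
  have h := LinearMap.finrank_range_le f
  rw [hr, finrank_top] at h
  rw [HasFullRank, hr, finrank_top, min_eq_right h]

variable [FiniteDimensional k V] [FiniteDimensional k W]

lemma HasFullRank.injective_or_surjective {f : V →ₗ[k] W} (hf : HasFullRank f) :
    Function.Injective f ∨ Function.Surjective f := by
  rw [HasFullRank] at hf
  rcases le_total (Module.finrank k V) (Module.finrank k W) with h | h
  · left
    rw [min_eq_left h] at hf
    have := LinearMap.finrank_range_add_finrank_ker f
    rw [← LinearMap.ker_eq_bot, ← Submodule.finrank_eq_zero]
    omega
  · right
    rw [min_eq_right h] at hf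
    exact LinearMap.range_eq_top.1 (Submodule.eq_top_of_finrank_eq hf)

/-- Having full rank is an open condition on lines. -/
lemma HasFullRank.finite_not_add_smul {f : V →ₗ[k] W} (hf : HasFullRank f) (g : V →ₗ[k] W) :
    {t : k | ¬ HasFullRank (f + t • g)}.Finite := by
  rcases hf.injective_or_surjective with h | h
  -- A one-sided inverse of f reduces the question to perturbations of the identity.
  · obtain ⟨s, hs⟩ := f.exists_leftInverse_of_injective (LinearMap.ker_eq_bot.2 h)
    refine (finite_not_injective_one_add_smul (s ∘ₗ g)).subset fun t ht hinj => ht ?_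
    apply hasFullRank_of_injective
    have : (1 + t • (s ∘ₗ g) : Module.End k V) = s ∘ₗ (f + t • g) := by
      rw [LinearMap.comp_add, hs, LinearMap.comp_smul]; rfl
    rw [this, LinearMap.coe_comp] at hinj
    exact hinj.of_comp
  · obtain ⟨s, hs⟩ := f.exists_rightInverse_of_surjective (LinearMap.range_eq_top.2 h)
    refine (finite_not_injective_one_add_smul (g ∘ₗ s)).subset fun t ht hinj => ht ?_
    apply hasFullRank_of_surjective
    have : (1 + t • (g ∘ₗ s) : Module.End k W) = (f + t • g) ∘ₗ s := by
      rw [LinearMap.add_comp, hs, LinearMap.smul_comp]; rfl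
    rw [this] at hinj
    have hsurj := LinearMap.injective_iff_surjective.1 hinj
    rw [LinearMap.coe_comp] at hsurj
    exact hsurj.of_comp

end FullRank

/-! ### Generic cones, a substitute for nonempty Zariski open sets -/

section LineOpen

variable {k X : Type*} [Field k] [AddCommGroup X] [Module k X]

/-- A nonempty cone whose complement meets every line through one of its points in a finite
set of points. -/
structure IsGenericCone (k : Type*) {X : Type*} [Field k] [AddCommGroup X] [Module k X]
    (U : Set X) : Prop where
  nonempty : U.Nonempty
  smul_mem : ∀ t : k, t ≠ 0 → ∀ x ∈ U, t • x ∈ U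
  finite : ∀ x ∈ U, ∀ y : X, {t : k | x + t • y ∉ U}.Finite

/-- With x in U and y in V, the point x + t y lies in U for almost all t. It is also t (y + t⁻¹ x),
so by scaling it lies in V for almost all t. -/
lemma IsGenericCone.inter [Infinite k] {U V : Set X} (hU : IsGenericCone k U)
    (hV : IsGenericCone k V) : IsGenericCone k (U ∩ V) where
  nonempty := by
    obtain ⟨x, hx⟩ := hU.nonempty
    obtain ⟨y, hy⟩ := hV.nonempty
    obtain ⟨t, ht⟩ := (((hU.finite x hx y).union
      (((hV.finite y hy x).image (·⁻¹)))).union (Set.finite_singleton 0)).exists_notMem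
    simp only [Set.mem_union, Set.mem_ofPred_eq, Set.mem_image, Set.mem_singleton_iff, not_or,
      not_not, not_exists, not_and] at ht
    obtain ⟨⟨h1, h2⟩, h3⟩ := ht
    refine ⟨x + t • y, h1, ?_⟩
    have h4 : y + t⁻¹ • x ∈ V := by
      by_contra h
      exact h2 t⁻¹ h (inv_inv t)
    have := hV.smul_mem t h3 _ h4
    rwa [smul_add, smul_smul, mul_inv_cancel₀ h3, one_smul, add_comm] at this
  smul_mem t ht x hx := ⟨hU.smul_mem t ht x hx.1, hV.smul_mem t ht x hx.2⟩
  finite x hx y := ((hU.finite x hx.1 y).union (hV.finite x hx.2 y)).subset fun t ht => by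
    by_contra h
    simp only [Set.mem_union, Set.mem_ofPred_eq, not_or, not_not] at h
    exact ht h

end LineOpen

end Lefschetz

noncomputable section

namespace Lefschetz

/-! ### Gradings indexed by integers, and dual numbers as a graded algebra -/

section IntGrading

variable {k : Type*} [Field k] {A B : Type*} [CommRing A] [Algebra k A] [CommRing B] [Algebra k B]

/-- Extension of a grading by zero to negative degrees. -/
def intGrading (𝒜 : ℕ → Submodule k A) (i : ℤ) : Submodule k A :=
  if 0 ≤ i then 𝒜 i.toNat else ⊥

@[simp] lemma intGrading_natCast (𝒜 : ℕ → Submodule k A) (d : ℕ) : intGrading 𝒜 d = 𝒜 d := by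
  simp [intGrading]

lemma intGrading_of_neg (𝒜 : ℕ → Submodule k A) {i : ℤ} (hi : i < 0) : intGrading 𝒜 i = ⊥ :=
  if_neg (by omega)

lemma intGrading_mul_mem {𝒜 : ℕ → Submodule k A} [SetLike.GradedMonoid 𝒜] {i j : ℤ} {a b : A}
    (ha : a ∈ intGrading 𝒜 i) (hb : b ∈ intGrading 𝒜 j) : a * b ∈ intGrading 𝒜 (i + j) := by
  rcases lt_or_ge i 0 with hi | hi
  · rw [intGrading_of_neg _ hi, Submodule.mem_bot] at ha
    simp [ha]
  rcases lt_or_ge j 0 with hj | hj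
  · rw [intGrading_of_neg _ hj, Submodule.mem_bot] at hb
    simp [hb]
  lift i to ℕ using hi
  lift j to ℕ using hj
  rw [intGrading_natCast] at ha hb
  rw [← Nat.cast_add, intGrading_natCast]
  exact SetLike.mul_mem_graded ha hb

/-- The grading of `B[ε]` with `ε` in degree one. -/
def dualGrading (ℬ : ℕ → Submodule k B) (d : ℕ) : Submodule k (DualNumber B) where
  carrier := {y | y.fst ∈ intGrading ℬ d ∧ y.snd ∈ intGrading ℬ (d - 1)}
  add_mem' hx hy := ⟨add_mem hx.1 hy.1, add_mem hx.2 hy.2⟩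
  zero_mem' := ⟨zero_mem _, zero_mem _⟩
  smul_mem' c _ hx := ⟨Submodule.smul_mem _ c hx.1, Submodule.smul_mem _ c hx.2⟩

instance dualGrading_gradedMonoid (ℬ : ℕ → Submodule k B) [SetLike.GradedMonoid ℬ] :
    SetLike.GradedMonoid (dualGrading ℬ) where
  one_mem := ⟨by
    rw [intGrading_natCast]
    exact SetLike.one_mem_graded ℬ, by simp⟩
  mul_mem := by
    rintro d e x y ⟨hx, hx'⟩ ⟨hy, hy'⟩
    refine ⟨?_, ?_⟩
    · rw [TrivSqZeroExt.fst_mul, Nat.cast_add]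
      exact intGrading_mul_mem hx hy
    · rw [DualNumber.snd_mul, Nat.cast_add]
      refine add_mem ?_ ?_
      · have := intGrading_mul_mem hx hy'
        rwa [show (d : ℤ) + (e - 1) = d + e - 1 by ring] at this
      · have := intGrading_mul_mem hx' hy
        rwa [show (d : ℤ) - 1 + e = d + e - 1 by ring] at this

/-- The family of square zero elements of `B[ε]` consisting of a given family and of `ε`. -/
def dualVars {n : ℕ} (f : Fin n → B) : Fin (n + 1) → DualNumber B :=
  Fin.lastCases DualNumber.eps fun i => TrivSqZeroExt.inl (f i)

@[simp] lemma dualVars_last {n : ℕ} (f : Fin n → B) :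
    dualVars f (Fin.last n) = DualNumber.eps := Fin.lastCases_last

@[simp] lemma dualVars_castSucc {n : ℕ} (f : Fin n → B) (i : Fin n) :
    dualVars f i.castSucc = TrivSqZeroExt.inl (f i) := Fin.lastCases_castSucc i

lemma dualVars_mul_self {n : ℕ} {f : Fin n → B} (hf : ∀ i, f i * f i = 0) (i : Fin (n + 1)) :
    dualVars f i * dualVars f i = 0 := by
  induction i using Fin.lastCases with
  | last => rw [dualVars_last, DualNumber.eps_mul_eps]
  | cast i => rw [dualVars_castSucc, ← TrivSqZeroExt.inl_mul, hf, TrivSqZeroExt.inl_zero]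

lemma dualVars_mem {n : ℕ} {ℬ : ℕ → Submodule k B} [SetLike.GradedMonoid ℬ] {f : Fin n → B}
    (hf : ∀ i, f i ∈ ℬ 1) (i : Fin (n + 1)) : dualVars f i ∈ dualGrading ℬ 1 := by
  induction i using Fin.lastCases with
  | last =>
    rw [dualVars_last]
    refine ⟨by simp, ?_⟩
    rw [DualNumber.snd_eps, Nat.cast_one, sub_self, ← Nat.cast_zero, intGrading_natCast]
    exact SetLike.one_mem_graded _
  | cast i =>
    rw [dualVars_castSucc]
    refine ⟨?_, by simp⟩
    rw [intGrading_natCast]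
    exact hf i

lemma aeval_mem_graded {𝒟 : ℕ → Submodule k B} [SetLike.GradedMonoid 𝒟] {σ : Type*} {f : σ → B}
    (hf : ∀ i, f i ∈ 𝒟 1) {p : MvPolynomial σ k} {d : ℕ} (hp : p.IsHomogeneous d) :
    MvPolynomial.aeval f p ∈ 𝒟 d := by
  rw [MvPolynomial.aeval_def, MvPolynomial.eval₂_eq]
  refine Submodule.sum_mem _ fun m hm => ?_
  rw [← Algebra.smul_def]
  refine Submodule.smul_mem _ _ ?_
  have h := SetLike.prod_pow_mem_graded (F := m.support) 𝒟 (fun _ => 1) f m fun j _ => hf j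
  have hd : m.degree = d := by
    by_contra hne
    exact MvPolynomial.mem_support_iff.1 hm (hp.coeff_eq_zero hne)
  rw [← hd, Finsupp.degree_apply]
  simpa using h

lemma tmul_mem_tensorGrading {𝒜 : ℕ → Submodule k A} {ℬ : ℕ → Submodule k B} {i j : ℕ} {a : A}
    {b : B} (ha : a ∈ 𝒜 i) (hb : b ∈ ℬ j) : a ⊗ₜ[k] b ∈ tensorGrading 𝒜 ℬ (i + j) :=
  Submodule.subset_span ⟨i, j, rfl, a, ha, b, hb, rfl⟩

lemma tmul_mem_intGrading {𝒜 : ℕ → Submodule k A} {ℬ : ℕ → Submodule k B} {i : ℕ} {j : ℤ} {a : A}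
    {b : B} (ha : a ∈ 𝒜 i) (hb : b ∈ intGrading ℬ j) :
    a ⊗ₜ[k] b ∈ intGrading (tensorGrading 𝒜 ℬ) (i + j) := by
  rcases lt_or_ge j 0 with hj | hj
  · rw [intGrading_of_neg _ hj, Submodule.mem_bot] at hb
    simp [hb]
  lift j to ℕ using hj
  rw [intGrading_natCast] at hb
  rw [← Nat.cast_add, intGrading_natCast]
  exact tmul_mem_tensorGrading ha hb

end IntGrading

/-! ### The squares algebra as an iterated extension by a square zero variable -/

section Squares

variable {k : Type*} [Field k] {B : Type*} [CommRing B] [Algebra k B] {n : ℕ}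

/-- The class of the variable `xᵢ`. -/
def squaresGen (k : Type*) [Field k] {n : ℕ} (i : Fin n) : SquaresAlgebra k n :=
  Ideal.Quotient.mkₐ k (squaresIdeal k n) (MvPolynomial.X i)

lemma squaresGen_mul_self (i : Fin n) : squaresGen k i * squaresGen k i = 0 := by
  rw [squaresGen, ← map_mul, ← pow_two, Ideal.Quotient.mkₐ_eq_mk, Ideal.Quotient.eq_zero_iff_mem]
  exact Ideal.subset_span ⟨i, rfl⟩

/-- The universal property of `k[x₁, …, xₙ] / (x₁², …, xₙ²)`. -/
def squaresLift (f : Fin n → B) (hf : ∀ i, f i * f i = 0) : SquaresAlgebra k n →ₐ[k] B :=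
  Ideal.Quotient.liftₐ (squaresIdeal k n) (MvPolynomial.aeval f) (by
    have h : squaresIdeal k n ≤ RingHom.ker (MvPolynomial.aeval f : _ →ₐ[k] B) := by
      rw [squaresIdeal, Ideal.span_le]
      rintro _ ⟨i, rfl⟩
      simp [RingHom.mem_ker, pow_two, hf]
    exact fun a ha => h ha)

lemma squaresLift_mk (f : Fin n → B) (hf : ∀ i, f i * f i = 0) (p : MvPolynomial (Fin n) k) :
    squaresLift f hf (Ideal.Quotient.mkₐ k (squaresIdeal k n) p) = MvPolynomial.aeval f p := rfl

@[simp] lemma squaresLift_gen (f : Fin n → B) (hf : ∀ i, f i * f i = 0) (i : Fin n) :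
    squaresLift f hf (squaresGen k i) = f i := by
  rw [squaresGen, squaresLift_mk, MvPolynomial.aeval_X]

/-- The extension to the dual numbers of a family of square zero elements. -/
def squaresLiftDual (f : Fin n → B) (hf : ∀ i, f i * f i = 0) :
    SquaresAlgebra k (n + 1) →ₐ[k] DualNumber B :=
  squaresLift (dualVars f) (dualVars_mul_self hf)

lemma squaresLiftDual_last (f : Fin n → B) (hf : ∀ i, f i * f i = 0) :
    squaresLiftDual f hf (squaresGen k (Fin.last n)) = DualNumber.eps := by
  simp [squaresLiftDual]

lemma squaresLiftDual_castSucc (f : Fin n → B) (hf : ∀ i, f i * f i = 0) (i : Fin n) :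
    squaresLiftDual f hf (squaresGen k i.castSucc) = TrivSqZeroExt.inl (f i) := by
  simp [squaresLiftDual]

lemma squaresAlgebra_algHom_ext {f g : SquaresAlgebra k n →ₐ[k] B}
    (h : ∀ i, f (squaresGen k i) = g (squaresGen k i)) : f = g :=
  Ideal.Quotient.algHom_ext _ (MvPolynomial.algHom_ext h)

variable (k n)

/-- The inclusion `k[x₁, …, xₙ] / (x₁², …, xₙ²) → k[x₁, …, xₙ₊₁] / (x₁², …, xₙ₊₁²)`. -/
def squaresIncl : SquaresAlgebra k n →ₐ[k] SquaresAlgebra k (n + 1) :=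
  squaresLift (fun i => squaresGen k i.castSucc) fun _ => squaresGen_mul_self _

/-- The map to the dual numbers sending the last variable to `ε`. -/
def squaresToDual : SquaresAlgebra k (n + 1) →ₐ[k] DualNumber (SquaresAlgebra k n) :=
  squaresLiftDual (squaresGen k) squaresGen_mul_self

/-- The inverse of `squaresToDual`. -/
def squaresOfDual : DualNumber (SquaresAlgebra k n) →ₐ[k] SquaresAlgebra k (n + 1) :=
  DualNumber.lift ⟨(squaresIncl k n, squaresGen k (Fin.last n)), squaresGen_mul_self _,
    fun _ => Commute.all _ _⟩

/-- Only this composite is needed: it gives surjectivity of `squaresDouble`, whose injectivity is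
read off from the dual number coordinates. -/
lemma squaresOfDual_comp_toDual :
    (squaresOfDual k n).comp (squaresToDual k n) = AlgHom.id k _ := by
  refine squaresAlgebra_algHom_ext fun i => ?_
  induction i using Fin.lastCases with
  | last =>
    rw [AlgHom.comp_apply, squaresToDual, squaresLiftDual_last, squaresOfDual,
      DualNumber.lift_apply_eps, AlgHom.id_apply]
  | cast i =>
    rw [AlgHom.comp_apply, squaresToDual, squaresLiftDual_castSucc, squaresOfDual,
      DualNumber.lift_apply_inl, AlgHom.id_apply]
    exact squaresLift_gen (fun i : Fin n => squaresGen k i.castSucc)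
      (fun _ => squaresGen_mul_self _) i

variable {k n} in
lemma squaresLiftDual_incl (f : Fin n → B) (hf : ∀ i, f i * f i = 0) (b : SquaresAlgebra k n) :
    squaresLiftDual f hf (squaresIncl k n b) = TrivSqZeroExt.inl (squaresLift f hf b) := by
  have h : (squaresLiftDual f hf).comp (squaresIncl k n) =
      (TrivSqZeroExt.inlAlgHom k B B).comp (squaresLift f hf) := by
    refine squaresAlgebra_algHom_ext fun i => ?_
    rw [AlgHom.comp_apply, AlgHom.comp_apply, squaresLift_gen, squaresIncl, squaresLift_gen,
      squaresLiftDual_castSucc, TrivSqZeroExt.inlAlgHom_apply]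
  exact DFunLike.congr_fun h b

lemma squaresLift_squaresGen :
    squaresLift (squaresGen k) squaresGen_mul_self = AlgHom.id k (SquaresAlgebra k n) :=
  squaresAlgebra_algHom_ext (squaresLift_gen _ _)

lemma squaresToDual_incl (b : SquaresAlgebra k n) :
    squaresToDual k n (squaresIncl k n b) = TrivSqZeroExt.inl b := by
  rw [squaresToDual, squaresLiftDual_incl, squaresLift_squaresGen, AlgHom.id_apply]

lemma squaresToDual_gen_last :
    squaresToDual k n (squaresGen k (Fin.last n)) = DualNumber.eps :=
  squaresLiftDual_last _ _

/-- The decomposition `S ⊕ S x` of `S[x] / (x²)`. -/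
def squaresDouble : (SquaresAlgebra k n × SquaresAlgebra k n) ≃ₗ[k] SquaresAlgebra k (n + 1) where
  toFun p := squaresIncl k n p.1 + squaresIncl k n p.2 * squaresGen k (Fin.last n)
  invFun y := ((squaresToDual k n y).fst, (squaresToDual k n y).snd)
  map_add' p q := by simp only [Prod.fst_add, Prod.snd_add, map_add]; ring
  map_smul' c p := by
    simp only [Prod.smul_fst, Prod.smul_snd, map_smul, smul_add, RingHom.id_apply,
      smul_mul_assoc]
  left_inv p := by
    simp [squaresToDual_incl, squaresToDual_gen_last]
  right_inv y := DFunLike.congr_fun (squaresOfDual_comp_toDual k n) y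

lemma squaresDouble_apply (p : SquaresAlgebra k n × SquaresAlgebra k n) :
    squaresDouble k n p = squaresIncl k n p.1 + squaresIncl k n p.2 * squaresGen k (Fin.last n) :=
  rfl

/-- Without variables, the algebra is the base field. -/
def squaresZero : SquaresAlgebra k 0 ≃ₐ[k] k :=
  AlgEquiv.ofAlgHom (squaresLift Fin.elim0 fun i => i.elim0) (Algebra.ofId k _)
    (by ext) (squaresAlgebra_algHom_ext fun i => i.elim0)

instance finite_squaresAlgebra : Module.Finite k (SquaresAlgebra k n) := by
  induction n with
  | zero => exact Module.Finite.equiv (squaresZero k).toLinearEquiv.symm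
  | succ n ih => exact Module.Finite.equiv (squaresDouble k n)

variable {k n}

lemma squaresGen_mem (i : Fin n) : squaresGen k i ∈ squaresGrading k n 1 :=
  ⟨_, MvPolynomial.isHomogeneous_X k i, rfl⟩

lemma squaresLift_mem {𝒟 : ℕ → Submodule k B} [SetLike.GradedMonoid 𝒟] (f : Fin n → B)
    (hf : ∀ i, f i * f i = 0) (hf1 : ∀ i, f i ∈ 𝒟 1) {d : ℕ} {b : SquaresAlgebra k n}
    (hb : b ∈ squaresGrading k n d) : squaresLift f hf b ∈ 𝒟 d := by
  obtain ⟨p, hp, rfl⟩ := hb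
  exact aeval_mem_graded hf1 hp

lemma squaresLiftDual_mem {ℬ : ℕ → Submodule k B} [SetLike.GradedMonoid ℬ] (f : Fin n → B)
    (hf : ∀ i, f i * f i = 0) (hf1 : ∀ i, f i ∈ ℬ 1) {d : ℕ} {b : SquaresAlgebra k (n + 1)}
    (hb : b ∈ squaresGrading k (n + 1) d) : squaresLiftDual f hf b ∈ dualGrading ℬ d :=
  squaresLift_mem _ _ (dualVars_mem hf1) hb

end Squares

section SquaresGrading

variable {k : Type*} [Field k] {n : ℕ}

lemma squaresIncl_mem {d : ℕ} {b : SquaresAlgebra k n} (hb : b ∈ squaresGrading k n d) :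
    squaresIncl k n b ∈ squaresGrading k (n + 1) d :=
  squaresLift_mem (𝒟 := squaresGrading k (n + 1)) _ _ (fun _ => squaresGen_mem _) hb

lemma squaresToDual_mem {d : ℕ} {b : SquaresAlgebra k (n + 1)}
    (hb : b ∈ squaresGrading k (n + 1) d) :
    squaresToDual k n b ∈ dualGrading (squaresGrading k n) d :=
  squaresLiftDual_mem (ℬ := squaresGrading k n) _ _ squaresGen_mem hb

lemma squaresGrading_zero_le : squaresGrading k n 0 ≤ Submodule.span k {1} := by
  rintro _ ⟨p, hp, rfl⟩
  have hp0 : p.totalDegree = 0 := Nat.le_zero.1 (MvPolynomial.IsHomogeneous.totalDegree_le hp)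
  rw [MvPolynomial.totalDegree_eq_zero_iff_eq_C] at hp0
  rw [hp0, Submodule.mem_span_singleton]
  exact ⟨p.coeff 0, (Algebra.algebraMap_eq_smul_one _).symm⟩

lemma squaresGrading_one_le :
    squaresGrading k n 1 ≤ Submodule.span k (Set.range (squaresGen k)) := by
  rw [squaresGrading, MvPolynomial.homogeneousSubmodule_one_eq_span_X, Submodule.map_span,
    ← Set.range_comp]
  exact le_rfl

lemma squaresGrading_of_isEmpty {d : ℕ} (hd : d ≠ 0) : squaresGrading k 0 d = ⊥ := by
  rw [eq_bot_iff]
  rintro _ ⟨p, hp, rfl⟩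
  have hp0 : p = 0 := by
    by_contra hne
    rw [MvPolynomial.eq_C_of_isEmpty p] at hp hne
    exact hd (MvPolynomial.IsHomogeneous.inj_right hp (MvPolynomial.isHomogeneous_C _ _) hne)
  simp [hp0]

end SquaresGrading

end Lefschetz

end

noncomputable section

namespace Lefschetz

/-! ### Tensoring with a square zero extension; linear forms -/

section Tensor

variable {k : Type*} [Field k] {A S S' : Type*} [CommRing A] [Algebra k A] [CommRing S]
  [Algebra k S] [CommRing S'] [Algebra k S']

/-- The graded algebra `S'` is `S[x] / (x²)` with `x` in degree one, via `D (u, v) = u + v x`. -/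
structure IsSquareExtension (ℬ : ℕ → Submodule k S) (ℬ' : ℕ → Submodule k S') (ι : S →ₐ[k] S')
    (x : S') (D : (S × S) ≃ₗ[k] S') : Prop where
  apply : ∀ p, D p = ι p.1 + ι p.2 * x
  sq : x * x = 0
  incl_mem : ∀ d, ∀ b ∈ ℬ d, ι b ∈ ℬ' d
  mem : x ∈ ℬ' 1
  symm_mem : ∀ d, ∀ b ∈ ℬ' d, (D.symm b).1 ∈ intGrading ℬ d ∧ (D.symm b).2 ∈ intGrading ℬ (d - 1)

variable (A) in
/-- The decomposition of `(A ⊗ S)[x] / (x²)`. -/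
def tensorDouble (D : (S × S) ≃ₗ[k] S') : ((A ⊗[k] S) × (A ⊗[k] S)) ≃ₗ[k] A ⊗[k] S' :=
  (TensorProduct.prodRight k k A S S).symm ≪≫ₗ TensorProduct.congr (LinearEquiv.refl k A) D

variable {𝒜 : ℕ → Submodule k A} {ℬ : ℕ → Submodule k S} {ℬ' : ℕ → Submodule k S'}
  {ι : S →ₐ[k] S'} {x : S'} {D : (S × S) ≃ₗ[k] S'}

lemma tensorDouble_tmul (a : A) (b b' : S) :
    tensorDouble A D (a ⊗ₜ b, a ⊗ₜ b') = a ⊗ₜ D (b, b') := by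
  simp [tensorDouble]

lemma tensorDouble_mk (u v : A ⊗[k] S) :
    tensorDouble A D (u, v) = tensorDouble A D (u, 0) + tensorDouble A D (0, v) := by
  rw [← map_add, Prod.mk_add_mk, add_zero, zero_add]

namespace IsSquareExtension

variable (h : IsSquareExtension ℬ ℬ' ι x D)
include h

lemma tensorDouble_tmul_zero (a : A) (b : S) : tensorDouble A D (a ⊗ₜ b, 0) = a ⊗ₜ ι b := by
  rw [← TensorProduct.tmul_zero S a, tensorDouble_tmul, h.apply]
  simp

lemma tensorDouble_zero_tmul (a : A) (b : S) :
    tensorDouble A D (0, a ⊗ₜ b) = a ⊗ₜ (ι b * x) := by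
  rw [← TensorProduct.tmul_zero S a, tensorDouble_tmul, h.apply]
  simp

lemma tensorDouble_left_mem {d : ℕ} {u : A ⊗[k] S} (hu : u ∈ tensorGrading 𝒜 ℬ d) :
    tensorDouble A D (u, 0) ∈ tensorGrading 𝒜 ℬ' d := by
  suffices hle : tensorGrading 𝒜 ℬ d ≤
      (tensorGrading 𝒜 ℬ' d).comap ((tensorDouble A D).toLinearMap ∘ₗ
        LinearMap.inl k _ _) from hle hu
  rw [tensorGrading, Submodule.span_le]
  rintro _ ⟨i, j, rfl, a, ha, b, hb, rfl⟩
  change tensorDouble A D (a ⊗ₜ b, 0) ∈ tensorGrading 𝒜 ℬ' (i + j)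
  rw [h.tensorDouble_tmul_zero]
  exact tmul_mem_tensorGrading ha (h.incl_mem _ _ hb)

lemma tensorDouble_right_mem [SetLike.GradedMonoid ℬ'] {d : ℕ} {u : A ⊗[k] S}
    (hu : u ∈ tensorGrading 𝒜 ℬ d) : tensorDouble A D (0, u) ∈ tensorGrading 𝒜 ℬ' (d + 1) := by
  suffices hle : tensorGrading 𝒜 ℬ d ≤
      (tensorGrading 𝒜 ℬ' (d + 1)).comap ((tensorDouble A D).toLinearMap ∘ₗ
        LinearMap.inr k _ _) from hle hu
  conv_lhs => rw [tensorGrading]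
  rw [Submodule.span_le]
  rintro _ ⟨i, j, rfl, a, ha, b, hb, rfl⟩
  change tensorDouble A D (0, a ⊗ₜ b) ∈ tensorGrading 𝒜 ℬ' (i + j + 1)
  rw [h.tensorDouble_zero_tmul, add_assoc]
  exact tmul_mem_tensorGrading ha (SetLike.mul_mem_graded (h.incl_mem _ _ hb) h.mem)

/-- With integer degrees, M'(i) = M(i) ⊕ M(i-1) x holds without exception at i = 0. -/
lemma tensorGrading_eq_map [SetLike.GradedMonoid ℬ'] (i : ℤ) :
    intGrading (tensorGrading 𝒜 ℬ') i =
      ((intGrading (tensorGrading 𝒜 ℬ) i).prod (intGrading (tensorGrading 𝒜 ℬ) (i - 1))).map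
        (tensorDouble A D : _ →ₗ[k] A ⊗[k] S') := by
  rcases lt_or_ge i 0 with hi | hi
  · simp [intGrading_of_neg _ hi, intGrading_of_neg _ (show i - 1 < 0 by omega)]
  lift i to ℕ using hi
  rw [intGrading_natCast, intGrading_natCast]
  apply le_antisymm
  · rw [tensorGrading, Submodule.span_le]
    rintro _ ⟨d, j, rfl, a, ha, b, hb, rfl⟩
    obtain ⟨h0, h1⟩ := h.symm_mem _ _ hb
    refine ⟨(a ⊗ₜ (D.symm b).1, a ⊗ₜ (D.symm b).2), ⟨?_, ?_⟩, ?_⟩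
    · have := tmul_mem_intGrading ha h0
      rwa [← Nat.cast_add, intGrading_natCast] at this
    · have := tmul_mem_intGrading ha h1
      rwa [show (d : ℤ) + (j - 1) = (d + j : ℕ) - 1 by push_cast; ring] at this
    · rw [LinearEquiv.coe_coe, tensorDouble_tmul, Prod.mk.eta, D.apply_symm_apply]
  · rintro _ ⟨⟨u, v⟩, ⟨hu, hv⟩, rfl⟩
    rw [LinearEquiv.coe_coe, tensorDouble_mk]
    refine add_mem (h.tensorDouble_left_mem hu) ?_
    change v ∈ intGrading _ _ at hv
    rcases Nat.eq_zero_or_pos i with rfl | hi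
    · rw [intGrading_of_neg _ (by simp), Submodule.mem_bot] at hv
      rw [hv, Prod.mk_zero_zero, map_zero]
      exact zero_mem _
    · obtain ⟨e, rfl⟩ : ∃ e, i = e + 1 := ⟨i - 1, by omega⟩
      rw [Nat.cast_succ, add_sub_cancel_right, intGrading_natCast] at hv
      exact h.tensorDouble_right_mem hv

/-- Since x² = 0, multiplying u + v x by L + c x gives L u + (L v + c u) x, which is `doubleOp`. -/
lemma mulLeft_tensorDouble (l : A) (z : S) (c : k) (w : (A ⊗[k] S) × (A ⊗[k] S)) :
    LinearMap.mulLeft k (l ⊗ₜ[k] (1 : S') + 1 ⊗ₜ (ι z + c • x)) (tensorDouble A D w) =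
      tensorDouble A D (doubleOp (LinearMap.mulLeft k (l ⊗ₜ[k] (1 : S) + 1 ⊗ₜ z)) c w) := by
  suffices hc : LinearMap.mulLeft k (l ⊗ₜ[k] (1 : S') + 1 ⊗ₜ (ι z + c • x)) ∘ₗ
      (tensorDouble A D : _ →ₗ[k] A ⊗[k] S') = (tensorDouble A D : _ →ₗ[k] A ⊗[k] S') ∘ₗ
        doubleOp (LinearMap.mulLeft k (l ⊗ₜ[k] (1 : S) + 1 ⊗ₜ z)) c from DFunLike.congr_fun hc w
  apply LinearMap.prod_ext
  · refine TensorProduct.ext' fun a b => ?_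
    have h1 : LinearMap.mulLeft k (l ⊗ₜ[k] (1 : S) + 1 ⊗ₜ z) (a ⊗ₜ b) =
        (l * a) ⊗ₜ b + a ⊗ₜ (z * b) := by
      simp [add_mul]
    change LinearMap.mulLeft k _ (tensorDouble A D (a ⊗ₜ b, 0)) = tensorDouble A D
      (LinearMap.mulLeft k _ (a ⊗ₜ b), LinearMap.mulLeft k _ 0 + c • (a ⊗ₜ b))
    rw [h1, map_zero, zero_add, h.tensorDouble_tmul_zero, ← TensorProduct.tmul_smul,
      tensorDouble_mk ((l * a) ⊗ₜ[k] b + a ⊗ₜ[k] (z * b)), h.tensorDouble_zero_tmul,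
      show (((l * a) ⊗ₜ[k] b + a ⊗ₜ[k] (z * b), 0) : (A ⊗[k] S) × (A ⊗[k] S)) =
        ((l * a) ⊗ₜ[k] b, 0) + (a ⊗ₜ[k] (z * b), 0) by rw [Prod.mk_add_mk, add_zero],
      map_add, h.tensorDouble_tmul_zero, h.tensorDouble_tmul_zero]
    simp only [LinearMap.mulLeft_apply, add_mul, Algebra.TensorProduct.tmul_mul_tmul, one_mul,
      TensorProduct.tmul_add, map_mul, map_smul, smul_mul_assoc, add_assoc]
    rw [mul_comm x]
  · refine TensorProduct.ext' fun a b => ?_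
    have h1 : LinearMap.mulLeft k (l ⊗ₜ[k] (1 : S) + 1 ⊗ₜ z) (a ⊗ₜ b) =
        (l * a) ⊗ₜ b + a ⊗ₜ (z * b) := by
      simp [add_mul]
    change LinearMap.mulLeft k _ (tensorDouble A D (0, a ⊗ₜ b)) = tensorDouble A D
      (LinearMap.mulLeft k _ 0, LinearMap.mulLeft k _ (a ⊗ₜ b) + c • 0)
    rw [h1, map_zero, smul_zero, add_zero, h.tensorDouble_zero_tmul,
      show ((0, (l * a) ⊗ₜ[k] b + a ⊗ₜ[k] (z * b)) : (A ⊗[k] S) × (A ⊗[k] S)) =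
        (0, (l * a) ⊗ₜ[k] b) + (0, a ⊗ₜ[k] (z * b)) by rw [Prod.mk_add_mk, add_zero],
      map_add, h.tensorDouble_zero_tmul, h.tensorDouble_zero_tmul]
    have h2 : x * (ι b * x) = 0 := by rw [mul_left_comm, h.sq, mul_zero]
    simp only [LinearMap.mulLeft_apply, add_mul, Algebra.TensorProduct.tmul_mul_tmul, one_mul,
      map_mul, smul_mul_assoc, h2, smul_zero, add_zero, mul_assoc]

end IsSquareExtension

variable (A) in
/-- `A ⊗ S = A` if `S = k`. -/
def tensorScalar (e : S ≃ₐ[k] k) : A ≃ₗ[k] A ⊗[k] S :=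
  (TensorProduct.rid k A).symm ≪≫ₗ
    TensorProduct.congr (LinearEquiv.refl k A) e.symm.toLinearEquiv

lemma tensorScalar_apply (e : S ≃ₐ[k] k) (a : A) : tensorScalar A e a = a ⊗ₜ 1 := by
  simp [tensorScalar]

lemma tensorGrading_eq_map_of_trivial (e : S ≃ₐ[k] k) [SetLike.GradedMonoid ℬ]
    (hpos : ∀ d, d ≠ 0 → ℬ d = ⊥) (i : ℤ) :
    intGrading (tensorGrading 𝒜 ℬ) i =
      (intGrading 𝒜 i).map (tensorScalar A e : A →ₗ[k] A ⊗[k] S) := by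
  rcases lt_or_ge i 0 with hi | hi
  · simp [intGrading_of_neg _ hi]
  lift i to ℕ using hi
  rw [intGrading_natCast, intGrading_natCast]
  apply le_antisymm
  · rw [tensorGrading, Submodule.span_le]
    rintro _ ⟨d, j, rfl, a, ha, b, hb, rfl⟩
    rcases eq_or_ne j 0 with rfl | hj
    · have hb' : b = e b • (1 : S) := e.injective (by simp)
      refine ⟨e b • a, Submodule.smul_mem _ _ ha, ?_⟩
      rw [LinearEquiv.coe_coe, tensorScalar_apply, TensorProduct.smul_tmul, ← hb']
    · rw [hpos j hj, Submodule.mem_bot] at hb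
      rw [hb, TensorProduct.tmul_zero]
      exact zero_mem _
  · rintro _ ⟨a, ha, rfl⟩
    rw [LinearEquiv.coe_coe, tensorScalar_apply]
    have := tmul_mem_tensorGrading (j := 0) ha (SetLike.one_mem_graded ℬ)
    rwa [add_zero] at this

lemma mulLeft_tensorScalar (e : S ≃ₐ[k] k) (l a : A) :
    LinearMap.mulLeft k (l ⊗ₜ[k] (1 : S)) (tensorScalar A e a) =
      tensorScalar A e (LinearMap.mulLeft k l a) := by
  simp [tensorScalar_apply]

variable {n : ℕ}

/-- The linear form `l ⊗ 1 + 1 ⊗ (c₀ g₀ + ⋯ + cₙ₋₁ gₙ₋₁)` attached to `(l, c)`. -/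
def linearForm (𝒜 : ℕ → Submodule k A) (g : Fin n → S) : (𝒜 1 × (ℕ → k)) →ₗ[k] A ⊗[k] S :=
  ((TensorProduct.mk k A S).flip 1 ∘ₗ (𝒜 1).subtype ∘ₗ LinearMap.fst k _ _) +
  (TensorProduct.mk k A S 1 ∘ₗ
    (∑ i : Fin n, (LinearMap.proj (i : ℕ)).smulRight (g i)) ∘ₗ LinearMap.snd k _ _)

lemma linearForm_apply (g : Fin n → S) (x : 𝒜 1 × (ℕ → k)) :
    linearForm 𝒜 g x = (x.1 : A) ⊗ₜ 1 + 1 ⊗ₜ ∑ i : Fin n, x.2 i • g i := by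
  simp [linearForm, TensorProduct.tmul_sum]

lemma linearForm_congr (g : Fin n → S) {l : 𝒜 1} {c c' : ℕ → k} (h : ∀ i < n, c i = c' i) :
    linearForm 𝒜 g (l, c) = linearForm 𝒜 g (l, c') := by
  rw [linearForm_apply, linearForm_apply]
  simp [h]

lemma linearForm_mem [SetLike.GradedMonoid 𝒜] [SetLike.GradedMonoid ℬ] {g : Fin n → S}
    (hg : ∀ i, g i ∈ ℬ 1) (x : 𝒜 1 × (ℕ → k)) : linearForm 𝒜 g x ∈ tensorGrading 𝒜 ℬ 1 := by
  rw [linearForm_apply]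
  refine add_mem ?_ ?_
  · have := tmul_mem_tensorGrading (j := 0) x.1.2 (SetLike.one_mem_graded ℬ)
    rwa [add_zero] at this
  have := tmul_mem_tensorGrading (SetLike.one_mem_graded 𝒜) (Submodule.sum_mem
    (ℬ 1) fun (i : Fin n) (_ : i ∈ Finset.univ) => Submodule.smul_mem _ (x.2 i) (hg i))
  rwa [zero_add] at this

/-- The degree zero parts are scalars, so degree one of the tensor product is spanned by 𝒜₁ ⊗ 1 and
the 1 ⊗ gᵢ. Every weak Lefschetz element therefore comes from the parameter space. -/
lemma exists_linearForm_eq (h0 : 𝒜 0 ≤ LinearMap.range (Algebra.linearMap k A)) {g : Fin n → S}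
    (hS0 : ℬ 0 ≤ Submodule.span k {1}) (hS1 : ℬ 1 ≤ Submodule.span k (Set.range g))
    {L : A ⊗[k] S} (hL : L ∈ tensorGrading 𝒜 ℬ 1) : ∃ x, linearForm 𝒜 g x = L := by
  suffices h : tensorGrading 𝒜 ℬ 1 ≤ LinearMap.range (linearForm 𝒜 g) from h hL
  rw [tensorGrading, Submodule.span_le]
  rintro _ ⟨i, j, hij, a, ha, b, hb, rfl⟩
  obtain ⟨rfl, rfl⟩ | ⟨rfl, rfl⟩ : (i = 0 ∧ j = 1) ∨ (i = 1 ∧ j = 0) := by omega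
  · obtain ⟨α, rfl⟩ := h0 ha
    obtain ⟨c, rfl⟩ := (Submodule.mem_span_range_iff_exists_fun k).1 (hS1 hb)
    refine ⟨(0, fun i => if h : i < n then α * c ⟨i, h⟩ else 0), ?_⟩
    rw [linearForm_apply, Algebra.linearMap_apply, Algebra.algebraMap_eq_smul_one,
      TensorProduct.smul_tmul, Finset.smul_sum]
    simp [smul_smul]
  · obtain ⟨c, rfl⟩ := Submodule.mem_span_singleton.1 (hS0 hb)
    refine ⟨(c • ⟨a, ha⟩, 0), ?_⟩
    rw [linearForm_apply]
    simp [TensorProduct.smul_tmul]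

end Tensor

end Lefschetz

end

noncomputable section

namespace Lefschetz

/-! ### Lefschetz properties as rank conditions, and their genericity -/

section Graded

variable {k : Type*} [Field k] {A : Type*} [CommRing A] [Algebra k A] (𝒜 : ℕ → Submodule k A)

lemma map_mulLeft_intGrading_le [SetLike.GradedMonoid 𝒜] {l : A} (hl : l ∈ 𝒜 1) (i : ℤ) :
    (intGrading 𝒜 i).map (LinearMap.mulLeft k l) ≤ intGrading 𝒜 (i + 1) := by
  rintro _ ⟨a, ha, rfl⟩
  have hl' : l ∈ intGrading 𝒜 ((1 : ℕ) : ℤ) := by rwa [intGrading_natCast]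
  have := intGrading_mul_mem hl' ha
  rwa [Nat.cast_one, add_comm] at this

lemma hilbert_eq_rankBetween (L : Module.End k A) (i : ℤ) :
    hilbert 𝒜 i = rankBetween (intGrading 𝒜) L i i := by
  rw [rankBetween_self]
  rcases lt_or_ge i 0 with hi | hi
  · rw [intGrading_of_neg _ hi, finrank_bot, hilbert, if_neg (by omega)]
  · rw [hilbert, intGrading, if_pos hi, if_pos hi]

lemma hasFullRank_mulPow_iff [SetLike.GradedMonoid 𝒜] (l : 𝒜 1) (t i : ℕ) :
    HasFullRank (mulPow 𝒜 l t i) ↔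
      rankBetween (intGrading 𝒜) (LinearMap.mulLeft k (l : A)) i (i + t) =
        min (rankBetween (intGrading 𝒜) (LinearMap.mulLeft k (l : A)) i i)
          (rankBetween (intGrading 𝒜) (LinearMap.mulLeft k (l : A)) (i + t) (i + t)) := by
  have h : (LinearMap.range (mulPow 𝒜 l t i)).map (𝒜 (i + t)).subtype =
      (𝒜 i).map (LinearMap.mulLeft k ((l : A) ^ t)) := by
    rw [← LinearMap.range_comp, mulPow, LinearMap.subtype_comp_restrict, LinearMap.domRestrict,
      LinearMap.range_comp, Submodule.range_subtype]
  rw [HasFullRank, rankBetween_self, rankBetween_self, rankBetween_add, LinearMap.pow_mulLeft,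
    ← Nat.cast_add, intGrading_natCast, intGrading_natCast, ← h,
    Submodule.finrank_map_subtype_eq]

lemma forall_hasFullRank_mulPow_iff [FiniteDimensional k A] [SetLike.GradedMonoid 𝒜] (l : 𝒜 1)
    (t : ℕ) : (∀ i : ℕ, HasFullRank (mulPow 𝒜 l t i)) ↔
      ∀ i : ℤ, rankBetween (intGrading 𝒜) (LinearMap.mulLeft k (l : A)) i (i + t) =
        min (rankBetween (intGrading 𝒜) (LinearMap.mulLeft k (l : A)) i i)
          (rankBetween (intGrading 𝒜) (LinearMap.mulLeft k (l : A)) (i + t) (i + t)) := by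
  simp_rw [hasFullRank_mulPow_iff]
  refine ⟨fun h i => ?_, fun h i => h i⟩
  rcases lt_or_ge i 0 with hi | hi
  · have h1 := rankBetween_anti (intGrading 𝒜) (LinearMap.mulLeft k (l : A)) (le_refl i)
      (show i ≤ i + t by omega)
    have h2 : rankBetween (intGrading 𝒜) (LinearMap.mulLeft k (l : A)) i i = 0 := by
      rw [rankBetween_self, intGrading_of_neg _ hi, finrank_bot]
    omega
  · lift i to ℕ using hi
    exact h i

lemma mulPow_one_add_smul [SetLike.GradedMonoid 𝒜] (l l' : 𝒜 1) (t : k) (i : ℕ) :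
    mulPow 𝒜 (l + t • l') 1 i = mulPow 𝒜 l 1 i + t • mulPow 𝒜 l' 1 i := by
  ext a
  simp [mulPow, add_mul]

lemma mulPow_one_smul [SetLike.GradedMonoid 𝒜] (l : 𝒜 1) (t : k) (i : ℕ) :
    mulPow 𝒜 (t • l) 1 i = t • mulPow 𝒜 l 1 i := by
  ext a
  simp [mulPow]

/-- Being a weak Lefschetz element is a generic condition on the linear form. -/
lemma isGenericCone_of_weakLefschetz [FiniteDimensional k A] [SetLike.GradedMonoid 𝒜]
    {X : Type*} [AddCommGroup X] [Module k X] (f : X →ₗ[k] 𝒜 1)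
    (hfin : {i : ℕ | 𝒜 i ≠ ⊥}.Finite) (hne : ∃ x, ∀ i, HasFullRank (mulPow 𝒜 (f x) 1 i)) :
    IsGenericCone k {x | ∀ i, HasFullRank (mulPow 𝒜 (f x) 1 i)} where
  nonempty := hne
  smul_mem t ht x hx i := by
    have h := hx i
    rw [map_smul, mulPow_one_smul, HasFullRank, LinearMap.range_smul _ _ ht]
    exact h
  finite x hx y := by
    -- Only the finitely many degrees with nonzero source can fail.
    refine (hfin.biUnion fun i _ =>
      (hx i).finite_not_add_smul (mulPow 𝒜 (f y) 1 i)).subset fun t ht => ?_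
    rw [Set.mem_ofPred_eq, Set.mem_ofPred_eq, not_forall] at ht
    obtain ⟨i, hi⟩ := ht
    rw [map_add, map_smul, mulPow_one_add_smul] at hi
    refine Set.mem_biUnion (x := i) (fun hbot => hi ?_) hi
    have : Subsingleton (𝒜 i) := by rw [hbot]; infer_instance
    exact hasFullRank_of_injective (Function.injective_of_subsingleton _)

end Graded

/-- Only finitely many coordinates are constrained: along a line, infinitely many could vanish at
infinitely many different parameters. -/
lemma isGenericCone_coord_ne_zero {k X : Type*} [Field k] [AddCommGroup X] [Module k X]
    (K : ℕ) : IsGenericCone k {x : X × (ℕ → k) | ∀ j < K, x.2 j ≠ 0} where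
  nonempty := ⟨(0, 1), fun _ _ => one_ne_zero⟩
  smul_mem t ht x hx j hj := mul_ne_zero ht (hx j hj)
  finite x hx y := by
    refine ((Finset.range K).finite_toSet.biUnion (t := fun j => {-(x.2 j) / y.2 j})
      fun j _ => Set.finite_singleton _).subset fun t ht => ?_
    rw [Set.mem_ofPred_eq, Set.mem_ofPred_eq] at ht
    push Not at ht
    obtain ⟨j, hj, h0⟩ := ht
    refine Set.mem_biUnion (x := j) (by simpa using hj) ?_
    replace h0 : x.2 j + t * y.2 j = 0 := h0
    have hy : y.2 j ≠ 0 := by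
      intro hy
      rw [hy, mul_zero, add_zero] at h0
      exact hx j hj h0
    rw [Set.mem_singleton_iff, eq_div_iff hy]
    linear_combination h0

/-! ### The tower of algebras and the equivalence -/

section Tower

variable {k : Type*} [Field k] {A : Type*} [CommRing A] [Algebra k A]
  {S : ℕ → Type*} [∀ n, CommRing (S n)] [∀ n, Algebra k (S n)]

/-- A sequence of graded algebras `Sₙ` with the formal properties of
`k[x₁, …, xₙ] / (x₁², …, xₙ²)`. -/
structure IsSquareTower (ℬ : ∀ n, ℕ → Submodule k (S n)) (ι : ∀ n, S n →ₐ[k] S (n + 1))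
    (g : ∀ n, Fin n → S n) (D : ∀ n, (S n × S n) ≃ₗ[k] S (n + 1)) : Prop where
  ext : ∀ n, IsSquareExtension (ℬ n) (ℬ (n + 1)) (ι n) (g (n + 1) (Fin.last n)) (D n)
  gen_castSucc : ∀ n (i : Fin n), g (n + 1) i.castSucc = ι n (g n i)
  gen_mem : ∀ n i, g n i ∈ ℬ n 1
  zero_le : ∀ n, ℬ n 0 ≤ Submodule.span k {1}
  one_le : ∀ n, ℬ n 1 ≤ Submodule.span k (Set.range (g n))
  eq_bot : ∀ d, d ≠ 0 → ℬ 0 d = ⊥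

variable {ℬ : ∀ n, ℕ → Submodule k (S n)} {ι : ∀ n, S n →ₐ[k] S (n + 1)}
  {g : ∀ n, Fin n → S n} {D : ∀ n, (S n × S n) ≃ₗ[k] S (n + 1)}

/-- The ranks of the powers of the linear form attached to `(l, c)` on the algebras `A ⊗ Sₙ`. -/
def rankTable (𝒜 : ℕ → Submodule k A) (ℬ : ∀ n, ℕ → Submodule k (S n)) (g : ∀ n, Fin n → S n)
    (x : 𝒜 1 × (ℕ → k)) (n : ℕ) (i j : ℤ) : ℕ :=
  rankBetween (intGrading (tensorGrading 𝒜 (ℬ n))) (LinearMap.mulLeft k (linearForm 𝒜 (g n) x)) i j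

namespace IsSquareTower

variable {𝒜 : ℕ → Submodule k A}

lemma mulLeft_linearForm_succ (h : IsSquareTower ℬ ι g D) (n : ℕ) (x : 𝒜 1 × (ℕ → k))
    (w : (A ⊗[k] S n) × (A ⊗[k] S n)) :
    LinearMap.mulLeft k (linearForm 𝒜 (g (n + 1)) x) (tensorDouble A (D n) w) =
      tensorDouble A (D n) (doubleOp (LinearMap.mulLeft k (linearForm 𝒜 (g n) x)) (x.2 n) w) := by
  have hsum : ∑ i : Fin (n + 1), x.2 i • g (n + 1) i =
      ι n (∑ i : Fin n, x.2 i • g n i) + x.2 n • g (n + 1) (Fin.last n) := by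
    rw [Fin.sum_univ_castSucc, map_sum]
    simp only [map_smul, h.gen_castSucc, Fin.val_castSucc, Fin.val_last]
  rw [linearForm_apply, linearForm_apply, hsum]
  exact (h.ext n).mulLeft_tensorDouble _ _ _ _

lemma finite_ne_bot [∀ n, SetLike.GradedMonoid (ℬ n)] (h : IsSquareTower ℬ ι g D)
    (e : S 0 ≃ₐ[k] k) (hA : {i : ℤ | intGrading 𝒜 i ≠ ⊥}.Finite) (n : ℕ) :
    {i : ℤ | intGrading (tensorGrading 𝒜 (ℬ n)) i ≠ ⊥}.Finite := by
  induction n with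
  | zero =>
    refine hA.subset fun i hi hbot => hi ?_
    rw [tensorGrading_eq_map_of_trivial e h.eq_bot, hbot, Submodule.map_bot]
  | succ n ih =>
    refine (ih.union (ih.image (· + 1))).subset fun i hi => ?_
    by_contra hc
    rw [Set.mem_union, not_or, Set.mem_ofPred_eq, not_not] at hc
    have h2 : intGrading (tensorGrading 𝒜 (ℬ n)) (i - 1) = ⊥ := by
      by_contra h2
      exact hc.2 ⟨i - 1, h2, sub_add_cancel _ _⟩
    refine hi ?_
    rw [(h.ext n).tensorGrading_eq_map, hc.1, h2, Submodule.prod_bot, Submodule.map_bot]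

lemma rankTable_zero [∀ n, SetLike.GradedMonoid (ℬ n)] (h : IsSquareTower ℬ ι g D)
    (e : S 0 ≃ₐ[k] k) (x : 𝒜 1 × (ℕ → k)) (i j : ℤ) :
    rankTable 𝒜 ℬ g x 0 i j =
      rankBetween (intGrading 𝒜) (LinearMap.mulLeft k (x.1 : A)) i j := by
  refine rankBetween_transport (tensorScalar A e) (fun a => ?_)
    (tensorGrading_eq_map_of_trivial e h.eq_bot) i j
  rw [linearForm_apply, Finset.univ_eq_empty, Finset.sum_empty, TensorProduct.tmul_zero, add_zero]
  exact mulLeft_tensorScalar e _ _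

lemma isDoublingTable [CharZero k] [FiniteDimensional k A] [∀ n, FiniteDimensional k (S n)]
    [SetLike.GradedMonoid 𝒜] [∀ n, SetLike.GradedMonoid (ℬ n)] (h : IsSquareTower ℬ ι g D)
    {x : 𝒜 1 × (ℕ → k)} (hx : ∀ n, x.2 n ≠ 0) : IsDoublingTable (rankTable 𝒜 ℬ g x) := by
  have hL : ∀ n i, (intGrading (tensorGrading 𝒜 (ℬ n)) i).map
      (LinearMap.mulLeft k (linearForm 𝒜 (g n) x)) ≤ intGrading (tensorGrading 𝒜 (ℬ n)) (i + 1) :=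
    fun n => map_mulLeft_intGrading_le _ (linearForm_mem (h.gen_mem n) x)
  have hsucc : ∀ n i j, rankTable 𝒜 ℬ g x (n + 1) i j = rankBetween
      (fun i => (intGrading (tensorGrading 𝒜 (ℬ n)) i).prod
        (intGrading (tensorGrading 𝒜 (ℬ n)) (i - 1)))
      (doubleOp (LinearMap.mulLeft k (linearForm 𝒜 (g n) x)) (x.2 n)) i j := fun n i j =>
    rankBetween_transport (tensorDouble A (D n)) (h.mulLeft_linearForm_succ n x)
      (h.ext n).tensorGrading_eq_map i j
  refine ⟨fun n i => ?_, fun n i j hij => ?_, fun n i j hij => ?_, fun n i j hij => ?_,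
    fun n i hi j hj => ?_⟩
  · rw [hsucc]
    exact rankBetween_double_self _ _
  · rw [hsucc]
    exact rankBetween_double (hL n) (hx n) hij
  · exact rankBetween_anti _ _ hij (by omega)
  · exact rankBetween_mono (hL n) (by omega) hij
  · exact rankBetween_eq_of_surj (hL n) hi hj

/-- The linear forms in `A ⊗ Sₙ`, depending linearly on the parameters. -/
def formMap [SetLike.GradedMonoid 𝒜] [∀ n, SetLike.GradedMonoid (ℬ n)]
    (h : IsSquareTower ℬ ι g D) (n : ℕ) :
    (𝒜 1 × (ℕ → k)) →ₗ[k] tensorGrading 𝒜 (ℬ n) 1 :=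
  (linearForm 𝒜 (g n)).codRestrict _ (linearForm_mem (h.gen_mem n))

lemma coe_formMap [SetLike.GradedMonoid 𝒜] [∀ n, SetLike.GradedMonoid (ℬ n)]
    (h : IsSquareTower ℬ ι g D) (n : ℕ) (x : 𝒜 1 × (ℕ → k)) :
    (h.formMap n x : A ⊗[k] S n) = linearForm 𝒜 (g n) x := rfl

lemma weakLefschetz_formMap_iff [FiniteDimensional k A] [∀ n, FiniteDimensional k (S n)]
    [SetLike.GradedMonoid 𝒜] [∀ n, SetLike.GradedMonoid (ℬ n)] (h : IsSquareTower ℬ ι g D)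
    (n : ℕ) (x : 𝒜 1 × (ℕ → k)) :
    (∀ i, HasFullRank (mulPow (tensorGrading 𝒜 (ℬ n)) (h.formMap n x) 1 i)) ↔
      ∀ i, rankTable 𝒜 ℬ g x n i (i + 1) =
        min (rankTable 𝒜 ℬ g x n i i) (rankTable 𝒜 ℬ g x n (i + 1) (i + 1)) := by
  rw [forall_hasFullRank_mulPow_iff]
  simp only [Nat.cast_one, coe_formMap, rankTable]

lemma rankTable_congr {n : ℕ} {l : 𝒜 1} {c c' : ℕ → k} (hc : ∀ i < n, c i = c' i) :
    rankTable 𝒜 ℬ g (l, c) n = rankTable 𝒜 ℬ g (l, c') n := by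
  ext i j
  rw [rankTable, rankTable, linearForm_congr (g n) hc]

variable [CharZero k] [FiniteDimensional k A] [∀ n, FiniteDimensional k (S n)]
  [SetLike.GradedMonoid 𝒜] [∀ n, SetLike.GradedMonoid (ℬ n)]

/-- The parameter space is the same for all n, so the weak Lefschetz conditions at two levels can be
intersected there, giving one ℓ to which the combinatorial obstruction applies. -/
lemma exists_not_unbalanced (h : IsSquareTower ℬ ι g D) (e : S 0 ≃ₐ[k] k)
    (h0 : 𝒜 0 ≤ LinearMap.range (Algebra.linearMap k A))
    (hfin : {i : ℤ | intGrading 𝒜 i ≠ ⊥}.Finite)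
    (hW : ∀ n, HasWLP (tensorGrading 𝒜 (ℬ n))) :
    ∃ l : 𝒜 1,
      ¬ HasUnbalancedPair (rankBetween (intGrading 𝒜) (LinearMap.mulLeft k (l : A))) := by
  obtain ⟨d, hd⟩ : ∃ d : ℕ, ∀ i : ℤ, (d : ℤ) < i → intGrading 𝒜 i = ⊥ := by
    obtain ⟨b, hb⟩ := hfin.bddAbove
    refine ⟨b.toNat, fun i hi => ?_⟩
    by_contra hne
    have := hb hne
    omega
  have hcone : ∀ n, IsGenericCone k
      {x | ∀ i, HasFullRank (mulPow (tensorGrading 𝒜 (ℬ n)) (h.formMap n x) 1 i)} := by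
    intro n
    refine isGenericCone_of_weakLefschetz _ _ ?_ ?_
    · refine ((h.finite_ne_bot e hfin n).preimage Nat.cast_injective.injOn).subset fun i hi => ?_
      rw [Set.mem_preimage, Set.mem_ofPred_eq, intGrading_natCast]
      exact hi
    · obtain ⟨L, hL⟩ := hW n
      obtain ⟨x, hx⟩ := exists_linearForm_eq h0 (h.zero_le n) (h.one_le n) L.2
      exact ⟨x, by rwa [show h.formMap n x = L from Subtype.ext hx]⟩
  set N := 2 * d + 2
  obtain ⟨⟨l, c⟩, ⟨hx1, hx2⟩, hx3⟩ := (((hcone N).inter (hcone (N + 1))).inter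
    (isGenericCone_coord_ne_zero (N + 1))).nonempty
  rw [Set.mem_ofPred_eq, weakLefschetz_formMap_iff] at hx1 hx2
  -- The doubling recursion asks for nonzero coefficients at every level, while genericity controls
  -- only the first N + 1. Changing the later ones does not affect levels up to N + 1.
  let c' : ℕ → k := fun j => if j < N + 1 then c j else 1
  have hc' : ∀ j, c' j ≠ 0 := by
    intro j
    by_cases hj : j < N + 1
    · rw [show c' j = c j from if_pos hj]
      exact hx3 j hj
    · rw [show c' j = 1 from if_neg hj]
      exact one_ne_zero
  have hcc : ∀ n ≤ N + 1, rankTable 𝒜 ℬ g (l, c) n = rankTable 𝒜 ℬ g (l, c') n := fun n hn =>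
    rankTable_congr fun i hi => (if_pos (show i < N + 1 by omega)).symm
  rw [hcc _ (by omega)] at hx1 hx2
  have h00 : rankTable 𝒜 ℬ g (l, c') 0 =
      rankBetween (intGrading 𝒜) (LinearMap.mulLeft k (l : A)) := by
    ext i j
    exact h.rankTable_zero e _ i j
  have key := (h.isDoublingTable (x := (l, c')) hc').not_unbalanced_of_fullRank (D := d) (N := N)
    (fun p q hpq hor => ?_) le_rfl hx1 hx2
  · exact ⟨l, h00 ▸ key⟩
  · have hle := rankBetween_le_min (map_mulLeft_intGrading_le 𝒜 l.2) hpq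
    rw [rankBetween_self, rankBetween_self] at hle
    rw [h00]
    rcases hor with hp | hq
    · rw [intGrading_of_neg _ hp, finrank_bot] at hle
      omega
    · rw [hd q hq, finrank_bot] at hle
      omega

theorem forall_hasWLP_iff (h : IsSquareTower ℬ ι g D) (e : S 0 ≃ₐ[k] k)
    (h0 : 𝒜 0 ≤ LinearMap.range (Algebra.linearMap k A))
    (hfin : {i : ℤ | intGrading 𝒜 i ≠ ⊥}.Finite) :
    (∀ n, HasWLP (tensorGrading 𝒜 (ℬ n))) ↔ IsAlmostCentered 𝒜 ∧ HasSLP 𝒜 := by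
  constructor
  · intro hW
    obtain ⟨l, hl⟩ := h.exists_not_unbalanced e h0 hfin hW
    have hle : ∀ i j : ℤ, i ≤ j → rankBetween (intGrading 𝒜) (LinearMap.mulLeft k (l : A)) i j ≤
        min (rankBetween (intGrading 𝒜) (LinearMap.mulLeft k (l : A)) i i)
          (rankBetween (intGrading 𝒜) (LinearMap.mulLeft k (l : A)) j j) := fun i j hij =>
      rankBetween_le_min (map_mulLeft_intGrading_le 𝒜 l.2) hij
    refine ⟨?_, l, fun t _ i => ?_⟩
    · simp only [IsAlmostCentered, hilbert_eq_rankBetween 𝒜 (LinearMap.mulLeft k (l : A))]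
      exact almostCentered_of_not_unbalanced hl hle
    · rw [hasFullRank_mulPow_iff]
      exact fullRank_of_not_unbalanced hl hle _ _ (by omega)
  · rintro ⟨hc, l, hl⟩ n
    have hL := map_mulLeft_intGrading_le 𝒜 l.2
    simp only [IsAlmostCentered, hilbert_eq_rankBetween 𝒜 (LinearMap.mulLeft k (l : A))] at hc
    have hfull : ∀ i j : ℤ, i ≤ j →
        rankBetween (intGrading 𝒜) (LinearMap.mulLeft k (l : A)) i j =
          min (rankBetween (intGrading 𝒜) (LinearMap.mulLeft k (l : A)) i i)
            (rankBetween (intGrading 𝒜) (LinearMap.mulLeft k (l : A)) j j) := by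
      intro i j hij
      rcases hij.eq_or_lt with rfl | hlt
      · rw [min_self]
      · have := (forall_hasFullRank_mulPow_iff 𝒜 l (j - i).toNat).1 (hl _ (by omega)) i
        rwa [show i + ((j - i).toNat : ℤ) = j by omega] at this
    have hb := not_unbalanced_of_almostCentered hfull
      (fun i j j' hij hj => rankBetween_anti _ _ hij hj)
      (fun i i' j hi hij => rankBetween_mono hL hi hij) hc.1 hc.2
    -- The form ℓ + x₁ + ⋯ + xₙ is a weak Lefschetz element for every n.
    have hT := h.isDoublingTable (x := (l, 1)) (fun _ => one_ne_zero)
    refine ⟨h.formMap n (l, 1), (h.weakLefschetz_formMap_iff n _).2 ?_⟩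
    refine hT.fullRank_of_balanced ?_ n
    rwa [show rankTable 𝒜 ℬ g (l, 1) 0 =
      rankBetween (intGrading 𝒜) (LinearMap.mulLeft k (l : A)) from
        funext₂ (h.rankTable_zero e _)]

end IsSquareTower

end Tower

/-! ### Specialisation to the squares algebra and to artinian standard graded algebras -/

section Main

variable {k : Type*} [Field k]

lemma isSquareTower_squares :
    IsSquareTower (squaresGrading k) (squaresIncl k) (fun _ => squaresGen k) (squaresDouble k) where
  ext n :=
    { apply := squaresDouble_apply k n
      sq := squaresGen_mul_self _
      incl_mem := fun _ _ hb => squaresIncl_mem hb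
      mem := squaresGen_mem _
      symm_mem := fun _ _ hb => squaresToDual_mem hb }
  gen_castSucc n i := (squaresLift_gen (fun i : Fin n => squaresGen k i.castSucc)
    (fun _ => squaresGen_mul_self _) i).symm
  gen_mem _ := squaresGen_mem
  zero_le _ := squaresGrading_zero_le
  one_le _ := squaresGrading_one_le
  eq_bot _ := squaresGrading_of_isEmpty

variable {A : Type*} [CommRing A] [Algebra k A] {𝒜 : ℕ → Submodule k A}

lemma IsStandardGraded.finiteDimensional [IsArtinianRing A] [GradedAlgebra 𝒜]
    (hA : IsStandardGraded 𝒜) : FiniteDimensional k A := by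
  have : Algebra.FiniteType k A := by
    obtain ⟨s, hs⟩ := (Submodule.fg_iff_finiteDimensional _).2 hA.finite_one
    exact ⟨⟨s, by rw [← Algebra.adjoin_span, hs, hA.adjoin_one]⟩⟩
  exact (Module.finite_iff_isArtinianRing k A).2 inferInstance

lemma finite_intGrading_ne_bot [FiniteDimensional k A] [GradedAlgebra 𝒜] :
    {i : ℤ | intGrading 𝒜 i ≠ ⊥}.Finite := by
  have hind : iSupIndep 𝒜 := (DirectSum.Decomposition.isInternal 𝒜).submodule_iSupIndep
  refine ((WellFoundedGT.finite_ne_bot_of_iSupIndep hind).image (Nat.cast : ℕ → ℤ)).subset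
    fun i hi => ?_
  rcases lt_or_ge i 0 with h | h
  · exact absurd (intGrading_of_neg 𝒜 h) hi
  · lift i to ℕ using h
    rw [Set.mem_ofPred_eq, intGrading_natCast] at hi
    exact ⟨i, hi, rfl⟩

end Main

end Lefschetz

end

theorem proposition5p9 {k : Type*} [Field k] [CharZero k] {A : Type*} [CommRing A] [Algebra k A]
    [IsArtinianRing A] (𝒜 : ℕ → Submodule k A) [GradedAlgebra 𝒜]
    (hA : Lefschetz.IsStandardGraded 𝒜) :
    (∀ n : ℕ, Lefschetz.HasWLP (Lefschetz.tensorGrading 𝒜 (Lefschetz.squaresGrading k n))) ↔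
      Lefschetz.IsAlmostCentered 𝒜 ∧ Lefschetz.HasSLP 𝒜 := by
  have := hA.finiteDimensional
  exact Lefschetz.isSquareTower_squares.forall_hasWLP_iff (Lefschetz.squaresZero k) hA.zero_eq.le
    Lefschetz.finite_intGrading_ne_bot
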